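/- Let $\Theta$ (states) and $\mathcal A$ (pure receiver actions) be finite sets, $M$ a set of messages with the discrete topology, $\mu\in\Delta\Theta$ a prior with full support, and let $\tau:M\to T$ assign to each message its payoff-relevant content ($\tau=\mathrm{id}_M$ for general message-dependent sender preferences; $T$ a single point for cheap talk). The transparent sender utility is $u^0:\mathcal A\times T\to\mathbb R$, the receiver utility is $u_R\in\mathbb R^{\mathcal A\times\Theta}$, and a modification is a bounded function $v(a,t\mid\theta)$ on $(\mathcal A\times T)\times\Theta$; modifications carry the sup norm (for finite $T$ these are all elements of $\mathbb R^{(\mathcal A\times T)\times\Theta}$). Utilities are extended linearly to mixed actions. Assume (S): $u^0(a,\tau(m))\ne u^0(a',\tau(m'))$ for all messages $m,m'$ and all distinct pure actions $a\neq a'$. Write $\Sigma(u_S,u_R)$ for the perfect Bayesian equilibria (sender strategy $\mathscr M:\Theta\to\Delta M$, beliefs $\nu:M\to\Delta\Theta$, receiver strategy $\mathscr P:M\to\Delta\mathcal A$) of the game with sender utility $u_S(\cdot\mid\theta)$ and receiver utility $u_R$. For $\sigma\in\Sigma(u^0,u_R)$ let $\sigma(\theta)=\{(\mathscr P(m),\tau(m))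 : \mathscr M(\theta)(m)>0\}$; the communication graph $G(\sigma)$ is the bipartite graph on $\Theta\sqcup\bigcup_\theta\sigma(\theta)$ in which $\theta$ and $\pi$ are joined iff $\pi\in\sigma(\theta)$. Let $\mathrm{GM}(\sigma)$ be the set of modifications $v$ such that $\sum_{i=1}^N \big(v(\pi_i\mid\theta_i)-v(\pi_{i-1}\mid\theta_i)\big)>0$ for every path $(\theta_1,\pi_1,\dots,\theta_N,\pi_N)$ of $G(\sigma)$ with $N\ge2$ (pairwise distinct vertices), where $\pi_0:=\pi_N$. For a nonempty open set $\mathscr O$ of modifications, $\sigma$ is $\mathscr O$-stable if for every $v\in\mathscr O$ there are $\sigma^\epsilon\in\Sigma(u^0+\epsilon v,u_R)$, for all small $\epsilon>0$, with $\sigma^\epsilon\to\sigma$ in distribution as $\epsilon\to0^+$ (convergence of all message probabilities and of the actions following messages that are on path in $\sigma$). Then for Lebesgue-almost every $u_R\in\mathbb R^{\mathcal A\times\Theta}$ the following holds for every candidate equilibrium $\sigma\in\Sigma(u^0,u_R)$ such that (i) any two on-path messages inducing the same pure action have the same payoff-relevant content, and (ii) off-path messages are strictly deterred, i.e. there is $\delta>0$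 such that for each message $m'$ whose content $\tau(m')$ is never sent, some best response $p$ of the receiver to some belief satisfies $u^0(p,\tau(m'))\le\overline u-\delta$, where $\overline u$ is the sender's payoff in $\sigma$. (Both (i) and (ii) are automatic in cheap talk.) 1. For every nonempty open set $\mathscr O$ of modifications, $\sigma$ is $\mathscr O$-stable if and only if $\mathscr O\subseteq\mathrm{GM}(\sigma)$. 2. If $\sigma$ is $\mathscr O$-stable for some nonempty open $\mathscr O$, then $G(\sigma)$ is a tree. Conversely, if $\tau$ is injective (modifications may depend arbitrarily on the message) and $G(\sigma)$ is a tree, then $\sigma$ is $\mathscr O$-stable for some nonempty open $\mathscr O$. -/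

import Mathlib

open Filter Topology MeasureTheory
open scoped ENNReal

noncomputable section

namespace SenderReceiver

/-- Mixed actions (or beliefs) over a finite set. -/
abbrev Lottery (X : Type*) [Fintype X] : Type _ := stdSimplex ℝ X

/-- Expected value of `f` under the lottery `p`. -/
def expect {X : Type*} [Fintype X] (p : Lottery X) (f : X → ℝ) : ℝ :=
  ∑ x, (p : X → ℝ) x * f x

/-- A strategy profile with beliefs: the (mixed) sender strategy, the receiver's posterior after
each message, and the receiver's (mixed) action after each message. -/
structure Profile (Θ A M : Type*) [Fintype Θ] [Fintype A] where
  /-- the lottery over messages used by the sender in each state -/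
  send : Θ → PMF M
  /-- the receiver's belief after each message -/
  belief : M → Lottery Θ
  /-- the receiver's mixed action after each message -/
  act : M → Lottery A

section Game

variable {Θ A M T : Type*} [Fintype Θ] [Fintype A]

/-- The message `m` is on path: it is sent with positive probability in some state. -/
def Profile.Sent (σ : Profile Θ A M) (m : M) : Prop :=
  ∃ θ, m ∈ (σ.send θ).support

/-- `p` is a best response of the receiver to the belief `ν`. -/
def IsBestResponse (uR : A → Θ → ℝ) (ν : Lottery Θ) (p : Lottery A) : Prop :=
  ∀ q : Lottery A, expect ν (fun θ => expect q (fun a => uR a θ)) ≤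
    expect ν (fun θ => expect p (fun a => uR a θ))

/-- Perfect Bayesian equilibria of the game with prior `μ`, receiver utility `uR` and sender
utility `uS`; utilities are given on pure actions and extended to mixed actions by expectation.
`τ m` is the payoff-relevant content of the message `m`: the sender's utility depends on `m`
only through `τ m`. Fully message-dependent preferences are `τ = id`; cheap talk is a
one-point `T`. -/
structure IsEquilibrium (μ : Θ → ℝ) (τ : M → T) (uS : A → T → Θ → ℝ) (uR : A → Θ → ℝ)
    (σ : Profile Θ A M) : Prop where
  /-- in each state the sender's lottery is optimal: it only uses optimal messages -/
  sender : ∀ θ, ∀ m ∈ (σ.send θ).support, ∀ m' : M,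
    expect (σ.act m') (fun a => uS a (τ m') θ) ≤ expect (σ.act m) (fun a => uS a (τ m) θ)
  /-- on-path beliefs are given by Bayes' rule -/
  bayes : ∀ m, σ.Sent m → ∀ θ,
    (σ.belief m : Θ → ℝ) θ * ∑ θ', μ θ' * (σ.send θ' m).toReal = μ θ * (σ.send θ m).toReal
  /-- after every message the receiver best responds to the belief -/
  receiver : ∀ m, IsBestResponse uR (σ.belief m) (σ.act m)

/-- The transparent (state-independent) sender utility `u0`. -/
def transparent (u0 : A → T → ℝ) : A → T → Θ → ℝ := fun a t _ => u0 a t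

/-- Modifications `v(a, t | θ)`: bounded functions with the supremum norm. For finite `T` this is
the whole of `ℝ^((A × T) × Θ)` with its usual topology. -/
abbrev Modification (A T Θ : Type*) : Type _ := lp (fun _ : (A × T) × Θ => ℝ) ∞

/-- The perturbed sender utility `u0 + ε v`. -/
def perturbed (u0 : A → T → ℝ) (v : Modification A T Θ) (ε : ℝ) : A → T → Θ → ℝ :=
  fun a t θ => u0 a t + ε * v ((a, t), θ)

/-- The sender is never transparently indifferent between outcomes with distinct pure actions. -/
def AssumptionS (τ : M → T) (u0 : A → T → ℝ) : Prop :=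
  ∀ a a' : A, a ≠ a' → ∀ m m' : M, u0 a (τ m) ≠ u0 a' (τ m')

/-- `σ(θ)`: the pairs (mixed action, payoff-relevant message) that occur in state `θ`. Messages
with the same payoff-relevant content and the same induced action are consolidated. -/
def Profile.paths (σ : Profile Θ A M) (τ : M → T) (θ : Θ) : Set (Lottery A × T) :=
  {π | ∃ m ∈ (σ.send θ).support, π = (σ.act m, τ m)}

/-- `σ(Θ)`, the set of all equilibrium paths. -/
abbrev Profile.Node (σ : Profile Θ A M) (τ : M → T) : Type _ :=
  {π : Lottery A × T // ∃ θ, π ∈ σ.paths τ θ}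

/-- The communication graph: the bipartite graph on `Θ ⊔ σ(Θ)` with an edge between `θ` and `π`
whenever `π ∈ σ(θ)`. -/
def Profile.commGraph (σ : Profile Θ A M) (τ : M → T) : SimpleGraph (Θ ⊕ σ.Node τ) :=
  SimpleGraph.fromRel fun x y =>
    ∃ (θ : Θ) (π : σ.Node τ), x = Sum.inl θ ∧ y = Sum.inr π ∧ π.1 ∈ σ.paths τ θ

/-- The value `v(π | θ)` of a modification at a pair (mixed action, message content). -/
def Modification.val (v : Modification A T Θ) (π : Lottery A × T) (θ : Θ) : ℝ :=
  expect π.1 (fun a => v ((a, π.2), θ))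

/-- Graph monotonicity: for every path `(θ₁, π₁, …, θ_N, π_N)` of the communication graph with
`N = n + 2 ≥ 2`, and with `π₀ = π_N`, the sum of `v(π_i | θ_i) - v(π_{i-1} | θ_i)` is positive.
Indices live in `Fin (n + 2)`, where `0 - 1` is the last element. -/
def Profile.GM (σ : Profile Θ A M) (τ : M → T) : Set (Modification A T Θ) :=
  {v | ∀ (n : ℕ) (θ : Fin (n + 2) → Θ) (π : Fin (n + 2) → σ.Node τ),
    Function.Injective θ → Function.Injective π →
    (∀ i, (σ.commGraph τ).Adj (Sum.inl (θ i)) (Sum.inr (π i))) →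
    (∀ i j : Fin (n + 2), (j : ℕ) = (i : ℕ) + 1 →
      (σ.commGraph τ).Adj (Sum.inr (π i)) (Sum.inl (θ j))) →
    0 < ∑ i, (v.val (π i).1 (θ i) - v.val (π (i - 1)).1 (θ i))}

/-- Convergence in distribution of `σ' ε` to `σ` as `ε → 0⁺`. For a prior of full support and a
discrete message space, convergence in law of (state, message, mixed action) amounts to
convergence of all message probabilities and of the actions after on-path messages. -/
def ConvergesTo (σ' : ℝ → Profile Θ A M) (σ : Profile Θ A M) : Prop :=
  (∀ θ m, Tendsto (fun ε => (σ' ε).send θ m) (𝓝[>] 0) (𝓝 (σ.send θ m))) ∧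
  (∀ m, σ.Sent m → Tendsto (fun ε => (σ' ε).act m) (𝓝[>] 0) (𝓝 (σ.act m)))

/-- `σ` is `O`-stable: for every `v ∈ O` it is the limit, as `ε → 0⁺`, of equilibria of the games
with sender utility `u0 + ε v`. -/
def OStable (μ : Θ → ℝ) (τ : M → T) (u0 : A → T → ℝ) (uR : A → Θ → ℝ) (σ : Profile Θ A M)
    (O : Set (Modification A T Θ)) : Prop :=
  ∀ v ∈ O, ∃ σ' : ℝ → Profile Θ A M,
    (∀ᶠ ε in 𝓝[>] (0 : ℝ), IsEquilibrium μ τ (perturbed u0 v ε) uR (σ' ε)) ∧ ConvergesTo σ' σ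

/-- No pure action is induced redundantly: on-path messages that induce the same pure action have
the same payoff-relevant content. (Automatic in cheap talk.) -/
def Profile.NoRedundantPure (σ : Profile Θ A M) (τ : M → T) : Prop :=
  ∀ m m' : M, σ.Sent m → σ.Sent m' →
    ∀ a : A, (σ.act m : A → ℝ) a = 1 → (σ.act m' : A → ℝ) a = 1 → τ m = τ m'

/-- Off-path messages are strictly unattractive: the off-path constraint
`ū ≥ max_m min_ν u*(ν, m)` is slack for messages whose payoff-relevant content is never sent.
(Automatic in cheap talk, and when all messages are sent.) -/
def Profile.OffPathDeterred (σ : Profile Θ A M) (τ : M → T) (u0 : A → T → ℝ)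
    (uR : A → Θ → ℝ) : Prop :=
  ∃ δ > 0, ∀ m' : M, (∀ m, σ.Sent m → τ m ≠ τ m') →
    ∃ (ν : Lottery Θ) (p : Lottery A), IsBestResponse uR ν p ∧
      ∀ m, σ.Sent m → expect p (fun a => u0 a (τ m')) + δ ≤ expect (σ.act m) (fun a => u0 a (τ m))

end Game

end SenderReceiver

end

/-!
Fix an equilibrium `σ` of the transparent game and call a pair (mixed action, content) that occurs
in it a node.

*Stability implies graph monotonicity* (`OStable.subset_GM`). If nearby games have nearby
equilibria, the sender's incentive constraints along an alternating path of the communication graph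
can be added up around the closed path. The transparent utility cancels, and in the limit the sum in
the definition of `GM` is nonnegative. That sum is a nonzero linear functional of the modification,
so on an open set it is positive. This direction needs no genericity.

*Graph monotonicity excludes cycles* (`Profile.isAcyclic_of_mem_GM`), since the two orientations of
a cycle give opposite sums.

*Generically an acyclic graph is a tree* (`IsEquilibrium.isTree_of_isAcyclic`). The receiver utility
is generic if no difference `uR a θ₁ - uR b θ₁` with `a ≠ b` lies in the field generated by the prior
and the utilities in the other states; this fails only on a countable union of null sets
(`ae_isGeneric`). The ex ante probabilities of the pairs (state, node) are weights on the edges of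
the graph. They sum to the prior at every state, and at every node with a properly mixed action they
satisfy a linear equation, the indifference of the receiver. Hence such a node has two neighbours,
so the graph is finite if it is acyclic. Suppose that a component has no node with a pure action.
Its farthest vertex from any given one is a leaf, hence a state `θ₁`. With `θ₁` as the root, the
equations determine the weights successively from the periphery inwards within the field belonging
to `θ₁`, and the equation at the neighbour of `θ₁` contradicts genericity
(`exists_reachable_of_generic_weights`). So each component has a node with a pure action, and there
is only one such node, because all nodes yield the same payoff.

*Graph monotonicity implies stability* (`IsEquilibrium.exists_perturbed_of_mem_GM`). The sender
strategy and the on-path beliefs are kept. At every node with a mixed action, mass is shifted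
between two actions of the support, which does not matter to the receiver but does to the sender.
Starting from the node with the pure action, the sizes of the shifts are determined along the tree
by the requirement that the sender stay indifferent between all nodes adjacent to a state
(`exists_forall_adj_of_isTree`, `exists_indifferent_shift`). A deviation to a node that is not
adjacent to the state loses, to first order in `ε`, the sum belonging to the path of the tree that
leads there (`eventually_payoff_le`). Messages off path copy an on-path message of the same content,
or are deterred by hypothesis.

*Interior of `GM`* (`Profile.exists_isOpen_subset_GM`). If the content identifies the message, the
modification that is one on the edges of an acyclic communication graph and zero elsewhere gives
every sum the value one, so a small ball around it lies in `GM`.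
-/

noncomputable section

namespace SenderReceiver

/-! ### Alternating paths and rooted forests -/

section Graph

variable {α β : Type*} {V : Type*}

/-- An alternating path `θ₀, π₀, θ₁, π₁, …, θ_n, π_n` in a graph on `α ⊕ β`. -/
structure IsAltPath (G : SimpleGraph (α ⊕ β)) {n : ℕ} (θ : Fin (n + 1) → α)
    (π : Fin (n + 1) → β) : Prop where
  inj_left : Function.Injective θ
  inj_right : Function.Injective π
  adj : ∀ i, G.Adj (Sum.inl (θ i)) (Sum.inr (π i))
  adj_succ : ∀ i j : Fin (n + 1), (j : ℕ) = (i : ℕ) + 1 → G.Adj (Sum.inr (π i)) (Sum.inl (θ j))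

/-- In a bipartite graph, a path from the left side to the right side is alternating. -/
theorem exists_isAltPath_of_isPath {G : SimpleGraph (α ⊕ β)}
    (hl : ∀ a a', ¬ G.Adj (Sum.inl a) (Sum.inl a')) (hr : ∀ b b', ¬ G.Adj (Sum.inr b) (Sum.inr b'))
    (b : β) : ∀ (L : ℕ) (a : α) (p : G.Walk (Sum.inl a) (Sum.inr b)), p.length ≤ L → p.IsPath →
      ∃ (n : ℕ) (θ : Fin (n + 1) → α) (π : Fin (n + 1) → β), IsAltPath G θ π ∧ θ 0 = a ∧
        π (Fin.last n) = b ∧ (∀ i, Sum.inl (θ i) ∈ p.support) ∧ ∀ i, Sum.inr (π i) ∈ p.support := by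
  intro L
  induction L using Nat.strong_induction_on with
  | _ L ih =>
  intro a p hL hp
  rcases p with _ | ⟨h, q⟩
  rename_i w
  rcases w with a' | b'
  · exact absurd h (hl _ _)
  rcases q with _ | ⟨h', r⟩
  · refine ⟨0, fun _ => a, fun _ => b, ⟨?_, ?_, fun _ => h, ?_⟩, rfl, rfl, ?_, ?_⟩
    · intro i j _; exact Subsingleton.elim (α := Fin 1) i j
    · intro i j _; exact Subsingleton.elim (α := Fin 1) i j
    · intro i j hij; have := j.2; omega
    · intro _; simp
    · intro _; simp
  rename_i w
  rcases w with a'' | b''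
  swap
  · exact absurd h' (hr _ _)
  rw [SimpleGraph.Walk.cons_isPath_iff, SimpleGraph.Walk.cons_isPath_iff] at hp
  obtain ⟨⟨hp, hb⟩, ha⟩ := hp
  have hlen : r.length < L := by
    simp only [SimpleGraph.Walk.length_cons] at hL; omega
  obtain ⟨n, θ, π, hA, h0, hn, hθ, hπ⟩ := ih _ hlen a'' r le_rfl hp
  refine ⟨n + 1, Fin.cons a θ, Fin.cons b' π, ⟨?_, ?_, ?_, ?_⟩, by simp, ?_, ?_, ?_⟩
  · rw [Fin.cons_injective_iff]
    refine ⟨?_, hA.inj_left⟩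
    rintro ⟨i, rfl⟩
    exact ha (by simp [hθ i])
  · rw [Fin.cons_injective_iff]
    refine ⟨?_, hA.inj_right⟩
    rintro ⟨i, rfl⟩
    exact hb (hπ i)
  · intro i
    refine Fin.cases ?_ (fun i => ?_) i
    · simpa using h
    · simpa using hA.adj i
  · intro i j hij
    rcases Fin.eq_zero_or_eq_succ j with rfl | ⟨j, rfl⟩
    · simp at hij
    rcases Fin.eq_zero_or_eq_succ i with rfl | ⟨i, rfl⟩
    · have : j = 0 := by
        ext; simpa using hij
      subst this
      simpa [h0] using h'
    · simpa using hA.adj_succ i j (by simpa using hij)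
  · rw [← Fin.succ_last]; simpa using hn
  · intro i
    refine Fin.cases ?_ (fun i => ?_) i
    · simp
    · simp [hθ i]
  · intro i
    refine Fin.cases ?_ (fun i => ?_) i
    · simp
    · simp [hπ i]

/-- In a bipartite graph, a vertex on the right that is reachable from but not adjacent to a vertex
on the left is reached by an alternating path through at least two vertices on either side. -/
theorem exists_isAltPath_of_not_adj {G : SimpleGraph (α ⊕ β)}
    (hl : ∀ a a', ¬ G.Adj (Sum.inl a) (Sum.inl a')) (hr : ∀ b b', ¬ G.Adj (Sum.inr b) (Sum.inr b'))
    {a : α} {b : β} (h : G.Reachable (Sum.inl a) (Sum.inr b))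
    (hab : ¬ G.Adj (Sum.inl a) (Sum.inr b)) :
    ∃ (n : ℕ) (θ : Fin (n + 2) → α) (π : Fin (n + 2) → β), IsAltPath G θ π ∧ θ 0 = a ∧
        π (Fin.last _) = b := by
  obtain ⟨p, hp⟩ := h.exists_isPath
  obtain ⟨n, θ, π, hA, h0, hn, -, -⟩ := exists_isAltPath_of_isPath hl hr b _ a p le_rfl hp
  rcases n with _ | n
  · exact absurd (h0 ▸ hn ▸ hA.adj 0) hab
  · exact ⟨n, θ, π, hA, h0, hn⟩

/-- A bipartite graph all of whose alternating paths with at least two vertices on either side have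
non-adjacent ends is acyclic. -/
theorem isAcyclic_of_isAltPath {G : SimpleGraph (α ⊕ β)}
    (hl : ∀ a a', ¬ G.Adj (Sum.inl a) (Sum.inl a')) (hr : ∀ b b', ¬ G.Adj (Sum.inr b) (Sum.inr b'))
    (h : ∀ (n : ℕ) (θ : Fin (n + 2) → α) (π : Fin (n + 2) → β), IsAltPath G θ π →
      ¬ G.Adj (Sum.inl (θ 0)) (Sum.inr (π (Fin.last _)))) : G.IsAcyclic := by
  have key : ∀ a b, G.Adj (Sum.inl a) (Sum.inr b) → G.IsBridge s(Sum.inl a, Sum.inr b) := by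
    intro a b hab
    rw [SimpleGraph.isBridge_iff]
    intro hre
    set H := G.deleteEdges {s(Sum.inl a, Sum.inr b)} with hH
    have hle : H ≤ G := SimpleGraph.deleteEdges_le _
    obtain ⟨n, θ, π, hA, h0, hn⟩ := exists_isAltPath_of_not_adj (G := H)
      (fun a a' h => hl a a' (hle h)) (fun b b' h => hr b b' (hle h)) hre
      (by simp [hH, SimpleGraph.deleteEdges_adj])
    refine h n θ π ⟨hA.inj_left, hA.inj_right, fun i => hle (hA.adj i),
      fun i j hij => hle (hA.adj_succ i j hij)⟩ ?_
    rw [h0, hn]; exact hab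
  rw [SimpleGraph.isAcyclic_iff_forall_adj_isBridge]
  rintro (a | b) (a' | b') hab
  · exact absurd hab (hl _ _)
  · exact key _ _ hab
  · rw [Sym2.eq_swap]; exact key _ _ hab.symm
  · exact absurd hab (hr _ _)

/-- The ends of an alternating path with at least two vertices on either side are not adjacent in
an acyclic graph. -/
theorem IsAltPath.not_adj_of_isAcyclic {G : SimpleGraph (α ⊕ β)} (hG : G.IsAcyclic) {n : ℕ}
    {θ : Fin (n + 2) → α} {π : Fin (n + 2) → β} (hA : IsAltPath G θ π) :
    ¬ G.Adj (Sum.inl (θ 0)) (Sum.inr (π (Fin.last _))) := by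
  intro hab
  have hb := SimpleGraph.isAcyclic_iff_forall_adj_isBridge.1 hG hab
  rw [SimpleGraph.isBridge_iff] at hb
  refine hb ?_
  set H := G.deleteEdges {s(Sum.inl (θ 0), Sum.inr (π (Fin.last _)))} with hH
  have hadj : ∀ i, H.Adj (Sum.inl (θ i)) (Sum.inr (π i)) := by
    intro i
    rw [hH, SimpleGraph.deleteEdges_adj]
    refine ⟨hA.adj i, ?_⟩
    simp only [Set.mem_singleton_iff, Sym2.eq_iff, Sum.inl.injEq, Sum.inr.injEq, reduceCtorEq,
      and_false, or_false, not_and]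
    intro h1 h2
    have h1 := hA.inj_left h1
    have h2 := hA.inj_right h2
    rw [h1] at h2
    exact absurd (congrArg Fin.val h2) (by simp)
  have hsucc : ∀ i j : Fin (n + 2), (j : ℕ) = i + 1 →
      H.Adj (Sum.inr (π i)) (Sum.inl (θ j)) := by
    intro i j hij
    rw [hH, SimpleGraph.deleteEdges_adj]
    refine ⟨hA.adj_succ i j hij, ?_⟩
    simp only [Set.mem_singleton_iff, Sym2.eq_iff, Sum.inl.injEq, Sum.inr.injEq, reduceCtorEq,
      and_false, not_and, false_or]
    intro h1 h2
    have h2 := hA.inj_left h2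
    rw [h2] at hij
    simp at hij
  have hre : ∀ (k : ℕ) (hk : k < n + 2), H.Reachable (Sum.inl (θ 0)) (Sum.inr (π ⟨k, hk⟩)) := by
    intro k
    induction k with
    | zero => intro hk; exact (hadj 0).reachable
    | succ k ih =>
      intro hk
      exact ((ih (by omega)).trans (hsucc ⟨k, by omega⟩ ⟨k + 1, hk⟩ rfl).reachable).trans
        (hadj _).reachable
  exact hre (n + 1) (by omega)

/-- In an acyclic graph every vertex has at most one neighbour that is closer to the root. -/
theorem eq_of_adj_of_dist_lt {G : SimpleGraph V} (hG : G.IsAcyclic) {r u w v : V}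
    (hv : G.Reachable r v) (hu : G.Adj u v) (hw : G.Adj w v) (hdu : G.dist r u < G.dist r v)
    (hdw : G.dist r w < G.dist r v) : u = w := by
  have key : ∀ u, G.Adj u v → G.dist r u < G.dist r v →
      ∃ p : G.Walk r u, ∃ h : G.Adj u v, (p.concat h).IsPath := by
    intro u hu hd
    obtain ⟨p, hp, hpl⟩ := (hv.trans hu.symm.reachable).exists_path_of_dist
    refine ⟨p, hu, hp.concat ?_ hu⟩
    intro hmem
    classical
    have := SimpleGraph.dist_le (p.takeUntil v hmem)
    have h2 := p.length_takeUntil_le_length hmem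
    omega
  obtain ⟨p, h, hp⟩ := key u hu hdu
  obtain ⟨q, h', hq⟩ := key w hw hdw
  have := congrArg Subtype.val ((hG.subsingleton_path r v).elim ⟨_, hp⟩ ⟨_, hq⟩)
  have := congrArg SimpleGraph.Walk.penultimate this
  simpa using this

/-- Every vertex but the root has a neighbour on a shortest path to the root. -/
theorem exists_adj_dist_add_one {G : SimpleGraph V} {r v : V} (h : G.Reachable r v) (hv : v ≠ r) :
    ∃ u, G.Adj u v ∧ G.dist r u + 1 = G.dist r v := by
  obtain ⟨p, hp⟩ := h.exists_walk_length_eq_dist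
  have hnil : ¬ p.Nil := SimpleGraph.Walk.not_nil_of_ne hv.symm
  refine ⟨p.penultimate, p.adj_penultimate hnil, ?_⟩
  have h1 := SimpleGraph.dist_le p.dropLast
  have h2 : p.dropLast.length + 1 = p.length := by
    simpa using SimpleGraph.Walk.length_dropLast_add_one hnil
  have h3 := SimpleGraph.Adj.diff_dist_adj (u := r) (p.adj_penultimate hnil)
  omega

/-- A relation along the edges of a finite tree that can always be extended from one end of an edge
to the other end can be satisfied at all edges simultaneously. -/
theorem exists_forall_adj_of_isTree [Finite V] {G : SimpleGraph V} (hG : G.IsTree) (r : V)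
    {X : Type*} (P : V → X → Prop) (R : V → V → X → X → Prop)
    (hsymm : ∀ u v x y, R u v x y → R v u y x) (hr : ∃ x, P r x)
    (hext : ∀ u v x, G.Adj u v → v ≠ r → P u x → ∃ y, P v y ∧ R u v x y) :
    ∃ f : V → X, (∀ v, P v (f v)) ∧ ∀ u v, G.Adj u v → R u v (f u) (f v) := by
  classical
  have hconn : ∀ v, G.Reachable r v := fun v => hG.connected.preconnected r v
  have : Nonempty X := ⟨hr.choose⟩
  have : Nonempty V := ⟨r⟩
  -- Solve the relations on balls around the root, by induction on the radius.
  have key : ∀ n : ℕ, ∃ f : V → X, (∀ v, G.dist r v ≤ n → P v (f v)) ∧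
      ∀ u v, G.Adj u v → G.dist r u ≤ n → G.dist r v ≤ n → R u v (f u) (f v) := by
    intro n
    induction n with
    | zero =>
      obtain ⟨x, hx⟩ := hr
      refine ⟨fun _ => x, fun v hv => ?_, fun u v huv hu hv => ?_⟩
      · rw [Nat.le_zero, (hconn v).dist_eq_zero_iff] at hv
        exact hv ▸ hx
      · rw [Nat.le_zero, (hconn v).dist_eq_zero_iff] at hv
        rw [Nat.le_zero, (hconn u).dist_eq_zero_iff] at hu
        exact absurd (hu.symm.trans hv) huv.ne
    | succ n ih =>
      obtain ⟨f, hP, hR⟩ := ih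
      have hpar : ∀ v, G.dist r v = n + 1 → ∃ u, G.Adj u v ∧ G.dist r u = n ∧
          ∃ y, P v y ∧ R u v (f u) y := by
        intro v hv
        have hne : v ≠ r := by rintro rfl; simp at hv
        obtain ⟨u, hu, hd⟩ := exists_adj_dist_add_one (hconn v) hne
        exact ⟨u, hu, by omega, hext u v (f u) hu hne (hP u (by omega))⟩
      choose! p hpadj hpd g hgP hgR using hpar
      have hedge : ∀ u v, G.Adj u v → G.dist r u ≤ n → G.dist r v = n + 1 → u = p v := by
        intro u v huv hu hv
        exact eq_of_adj_of_dist_lt hG.isAcyclic (hconn v) huv (hpadj v hv) (by omega)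
          (by rw [hpd v hv, hv]; omega)
      refine ⟨fun v => if G.dist r v ≤ n then f v else g v, fun v hv => ?_, fun u v huv hu hv => ?_⟩
      · by_cases h : G.dist r v ≤ n
        · simpa [h] using hP v h
        · simpa [h] using hgP v (by omega)
      · by_cases h1 : G.dist r u ≤ n <;> by_cases h2 : G.dist r v ≤ n
        · simpa [h1, h2] using hR u v huv h1 h2
        · have := hedge u v huv h1 (by omega)
          have h3 := hgR v (by omega)
          rw [← this] at h3
          simpa [h1, h2] using h3
        · have := hedge v u huv.symm h2 (by omega)
          have h3 := hgR u (by omega)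
          rw [← this] at h3
          simpa [h1, h2] using hsymm _ _ _ _ h3
        · exact absurd (by omega) (hG.dist_ne_of_adj r huv)
  obtain ⟨N, hN⟩ : ∃ N, ∀ v, G.dist r v ≤ N := by
    have := Fintype.ofFinite V
    exact ⟨Finset.univ.sup (G.dist r), fun v => Finset.le_sup (Finset.mem_univ v)⟩
  obtain ⟨f, hP, hR⟩ := key N
  exact ⟨f, fun v => hP v (hN v), fun u v huv => hR u v huv (hN u) (hN v)⟩

end Graph

/-! ### Generic receiver utilities -/

section Generic

variable {Θ A : Type*}

/-- The field generated by the prior and the receiver's utilities in all states but `θ₁`. -/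
def otherStatesField (μ : Θ → ℝ) (uR : A → Θ → ℝ) (θ₁ : Θ) : Subfield ℝ :=
  Subfield.closure (Set.range (Sum.elim μ fun p : A × {θ // θ ≠ θ₁} => uR p.1 p.2))

/-- A receiver utility is generic if the difference between the utilities of two actions in a state
is never algebraically determined (by field operations) by the prior and the utilities in the other
states. -/
def IsGeneric (μ : Θ → ℝ) (uR : A → Θ → ℝ) : Prop :=
  ∀ (θ₁ : Θ) (a b : A), a ≠ b → uR a θ₁ - uR b θ₁ ∉ otherStatesField μ uR θ₁

theorem prior_mem_otherStatesField (μ : Θ → ℝ) (uR : A → Θ → ℝ) (θ₁ θ : Θ) :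
    μ θ ∈ otherStatesField μ uR θ₁ :=
  Subfield.subset_closure ⟨Sum.inl θ, rfl⟩

theorem utility_mem_otherStatesField (μ : Θ → ℝ) (uR : A → Θ → ℝ) {θ₁ θ : Θ} (h : θ ≠ θ₁) (a : A) :
    uR a θ ∈ otherStatesField μ uR θ₁ :=
  Subfield.subset_closure ⟨Sum.inr (a, ⟨θ, h⟩), rfl⟩

/-- Elements of a generated field as quotients of polynomial values; the value `0` of a division by
zero belongs to the field as well. -/
theorem mem_closure_range_iff {ι : Type*} (s : ι → ℝ) (x : ℝ) :
    x ∈ Subfield.closure (Set.range s) ↔ ∃ P Q : MvPolynomial ι ℤ,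
      MvPolynomial.aeval s P / MvPolynomial.aeval s Q = x := by
  have h : ∀ y, y ∈ Subring.closure (Set.range s) ↔
      ∃ P : MvPolynomial ι ℤ, MvPolynomial.aeval s P = y := by
    intro y
    have h1 : y ∈ Algebra.adjoin ℤ (Set.range s) ↔ y ∈ Subring.closure (Set.range s) := by
      rw [Algebra.adjoin_int]; rfl
    rw [← h1, Algebra.adjoin_range_eq_range_aeval]
    rfl
  rw [Subfield.mem_closure_iff]
  constructor
  · rintro ⟨y, hy, z, hz, rfl⟩
    obtain ⟨P, rfl⟩ := (h y).1 hy
    obtain ⟨Q, rfl⟩ := (h z).1 hz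
    exact ⟨P, Q, rfl⟩
  · rintro ⟨P, Q, rfl⟩
    exact ⟨_, (h _).2 ⟨P, rfl⟩, _, (h _).2 ⟨Q, rfl⟩, rfl⟩

/-- A measurable function that grows at unit speed along one direction vanishes almost nowhere,
since it has a single zero on every line in that direction. -/
theorem ae_ne_zero_of_forall_line {E : Type*} [NormedAddCommGroup E] [NormedSpace ℝ E]
    [FiniteDimensional ℝ E] [MeasurableSpace E] [BorelSpace E] (ν : Measure E)
    [ν.IsAddHaarMeasure] (f : E → ℝ) (hf : Measurable f) (e : E)
    (h : ∀ y (t : ℝ), f (y + t • e) = f y + t) : ∀ᵐ y ∂ν, f y ≠ 0 := by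
  refine ae_mem_of_ae_add_linearMap_mem (LinearMap.toSpanSingleton ℝ E e) (volume : Measure ℝ) ν
    (s := {y | f y ≠ 0}) (hf (measurableSet_singleton 0).compl) fun y => ?_
  have : {t : ℝ | ¬ (y + LinearMap.toSpanSingleton ℝ E e t ∈ {y | f y ≠ 0})} ⊆ {-f y} := by
    intro t ht
    simp only [LinearMap.toSpanSingleton_apply, Set.mem_ofPred_eq, not_not, h] at ht
    simp only [Set.mem_singleton_iff]
    linarith
  rw [ae_iff]
  exact measure_mono_null this (by simp)

/-- An element of the field is a quotient of two integer polynomials in the generators. There are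
countably many such quotients, and none of them involves the coordinate `uR a θ₁`. -/
theorem ae_isGeneric [Fintype Θ] [Fintype A] (μ : Θ → ℝ) :
    ∀ᵐ uR : A → Θ → ℝ ∂volume, IsGeneric μ uR := by
  classical
  have (θ₁ : Θ) : Countable (MvPolynomial (Θ ⊕ A × {θ // θ ≠ θ₁}) ℤ) :=
    Cardinal.mk_le_aleph0_iff.1 (MvPolynomial.cardinalMk_le_max_lift.trans
      (sup_le (sup_le (by simp) (Cardinal.lift_le_aleph0.2 Cardinal.mk_le_aleph0)) le_rfl))
  unfold IsGeneric
  simp only [ae_all_iff, otherStatesField, mem_closure_range_iff, not_exists]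
  intro θ₁ a b hab P Q
  set s : (A → Θ → ℝ) → (Θ ⊕ A × {θ // θ ≠ θ₁}) → ℝ :=
    fun uR => Sum.elim μ fun p => uR p.1 p.2 with hs
  have hcont : Continuous s := by
    refine continuous_pi fun i => ?_
    rcases i with i | i
    · exact continuous_const
    · exact (continuous_apply _).comp (continuous_apply _)
  have hm : ∀ P : MvPolynomial (Θ ⊕ A × {θ // θ ≠ θ₁}) ℤ,
      Measurable fun uR => MvPolynomial.aeval (s uR) P := fun P => by
    have : Continuous fun x : (Θ ⊕ A × {θ // θ ≠ θ₁}) → ℝ => MvPolynomial.aeval x P := by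
      simp only [MvPolynomial.aeval_def, MvPolynomial.eval₂_eq]
      fun_prop
    exact (this.comp hcont).measurable
  have hd : Measurable fun uR : A → Θ → ℝ => uR a θ₁ - uR b θ₁ := by fun_prop
  have := ae_ne_zero_of_forall_line (volume : Measure (A → Θ → ℝ))
    (fun uR => uR a θ₁ - uR b θ₁ - MvPolynomial.aeval (s uR) P / MvPolynomial.aeval (s uR) Q)
    (hd.sub ((hm P).div (hm Q))) (Pi.single a (Pi.single θ₁ 1)) ?_
  · filter_upwards [this] with uR h h'
    exact h (by rw [← h', sub_self])
  · intro y t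
    have h1 : s (y + t • (Pi.single a (Pi.single θ₁ 1) : A → Θ → ℝ)) = s y := by
      funext i
      rcases i with i | ⟨c, θ, hθ⟩
      · rfl
      · by_cases hc : c = a
        · subst hc; simp [hs, hθ]
        · simp [hs, hc]
    simp only [h1]
    simp [Pi.single_eq_of_ne hab.symm]
    ring

end Generic

/-! ### Generic weights on a forest -/

section Flow

variable {Θ B : Type*} [Fintype Θ] [Fintype B]

/-- Let `x` be weights on the edges of a finite bipartite forest on `Θ ⊔ B` with prescribed sums
`μ θ` at the vertices `θ`, and suppose that at every vertex `π` outside a set `S` the weights solve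
a linear equation with coefficients `d π θ` that are generic: `d π θ₁` is not in a field `K θ₁`
that contains all the `μ θ` and all other coefficients. Then there is a vertex of `S` in every
component. For otherwise the number of equations in a component exceeds the number of its edges:
rooting it at a leaf `θ₁`, all weights but that of the first edge lie in `K θ₁`, and so does the
coefficient of the first edge. -/
theorem exists_reachable_of_generic_weights {G : SimpleGraph (Θ ⊕ B)} (hG : G.IsAcyclic)
    (x : Θ → B → ℝ) (μ : Θ → ℝ) (d : B → Θ → ℝ) (S : Set B) (K : Θ → Subfield ℝ)
    (hx : ∀ θ π, G.Adj (Sum.inl θ) (Sum.inr π) ↔ x θ π ≠ 0) (hμ : ∀ θ, μ θ ≠ 0)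
    (hsum : ∀ θ, ∑ π, x θ π = μ θ) (hd : ∀ π ∉ S, ∑ θ, x θ π * d π θ = 0)
    (hμK : ∀ θ₁ θ, μ θ ∈ K θ₁) (hdK : ∀ π ∉ S, ∀ θ₁ θ, θ ≠ θ₁ → d π θ ∈ K θ₁)
    (hgen : ∀ π ∉ S, ∀ θ₁, d π θ₁ ∉ K θ₁) (hne : ∀ π, ∃ θ, G.Adj (Sum.inl θ) (Sum.inr π))
    (v : Θ ⊕ B) : ∃ π ∈ S, G.Reachable v (Sum.inr π) := by
  classical
  by_contra! hcon
  have hx0 : ∀ θ π, ¬ G.Adj (Sum.inl θ) (Sum.inr π) → x θ π = 0 := fun θ π h => by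
    by_contra h'; exact h ((hx θ π).2 h')
  have hd0 : ∀ π ∉ S, ∀ θ, d π θ ≠ 0 := fun π hπ θ h => hgen π hπ θ (h ▸ (K θ).zero_mem)
  have hdeg : ∀ π ∉ S, ∀ θ, G.Adj (Sum.inl θ) (Sum.inr π) →
      ∃ θ', θ' ≠ θ ∧ G.Adj (Sum.inl θ') (Sum.inr π) := by
    intro π hπ θ hθ
    by_contra! h
    have h1 := hd π hπ
    rw [Finset.sum_eq_single θ (fun θ' _ h' => by rw [hx0 _ _ (h θ' h'), zero_mul]) (by simp)] at h1
    exact mul_ne_zero ((hx θ π).1 hθ) (hd0 π hπ θ) h1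
  -- The vertex farthest from `v` is a leaf.
  obtain ⟨w, hw, hmax⟩ := Set.exists_max_image {w | G.Reachable v w} (G.dist v) (Set.toFinite _)
    ⟨v, SimpleGraph.Reachable.refl v⟩
  have hleaf : ∀ u u', G.Adj u w → G.Adj u' w → u = u' := by
    have hlt : ∀ u, G.Adj u w → G.dist v u < G.dist v w := fun u hu =>
      lt_of_le_of_ne (hmax u (SimpleGraph.Reachable.trans hw hu.symm.reachable))
        (hG.dist_ne_of_adj hu (SimpleGraph.Reachable.trans hw hu.symm.reachable))
    exact fun u u' hu hu' => eq_of_adj_of_dist_lt hG hw hu hu' (hlt u hu) (hlt u' hu')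
  rcases w with θ₁ | π
  swap
  · obtain ⟨θ, hθ⟩ := hne π
    obtain ⟨θ', hne', hθ'⟩ := hdeg π (fun h => hcon π h hw) θ hθ
    exact hne' (by simpa using hleaf _ _ hθ' hθ)
  obtain ⟨π₁, hπ₁⟩ : ∃ π₁, G.Adj (Sum.inl θ₁) (Sum.inr π₁) := by
    by_contra! h
    exact hμ θ₁ (by rw [← hsum]; exact Finset.sum_eq_zero fun π _ => hx0 _ _ (h π))
  have hxμ : x θ₁ π₁ = μ θ₁ := by
    rw [← hsum, Finset.sum_eq_single π₁ _ (by simp)]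
    intro π _ hπ
    exact hx0 _ _ fun h => hπ (by simpa using hleaf _ _ h.symm hπ₁.symm)
  -- From here on the component is rooted at `θ₁`.
  set h : Θ ⊕ B → ℕ := G.dist (Sum.inl θ₁) with hh
  have hS : ∀ π, G.Reachable (Sum.inl θ₁) (Sum.inr π) → π ∉ S :=
    fun π hr hπ => hcon π hπ (SimpleGraph.Reachable.trans hw hr)
  have hfar : ∀ {u w u'}, G.Reachable (Sum.inl θ₁) w → G.Adj u w → h u < h w → G.Adj u' w →
      u' ≠ u → h w < h u' := by
    intro u w u' hw hu hlt hu' hne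
    by_contra! hle
    have hr' := SimpleGraph.Reachable.trans hw hu'.symm.reachable
    exact hne (eq_of_adj_of_dist_lt hG hw hu' hu
      (lt_of_le_of_ne hle (hG.dist_ne_of_adj hu' hr')) hlt)
  obtain ⟨N, hN⟩ : ∃ N, ∀ v, h v ≤ N :=
    ⟨Finset.univ.sup h, fun v => Finset.le_sup (Finset.mem_univ v)⟩
  -- Induction from the periphery inwards; `k` bounds the distance of the edge from the periphery.
  have key : ∀ k θ π, θ ≠ θ₁ → G.Adj (Sum.inl θ) (Sum.inr π) →
      G.Reachable (Sum.inl θ₁) (Sum.inl θ) →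
      N ≤ max (h (Sum.inl θ)) (h (Sum.inr π)) + k → x θ π ∈ K θ₁ := by
    intro k
    induction k using Nat.strong_induction_on with
    | _ k ih =>
    intro θ π hθ hadj hreach hk
    have hreachπ := hreach.trans hadj.reachable
    have hNθ := hN (Sum.inl θ)
    have hNπ := hN (Sum.inr π)
    rcases lt_or_gt_of_ne (hG.dist_ne_of_adj hadj hreach) with hlt | hlt
    · have h1 := hd π (hS π hreachπ)
      rw [← Finset.add_sum_erase _ _ (Finset.mem_univ θ)] at h1
      have h2 : ∑ θ' ∈ Finset.univ.erase θ, x θ' π * d π θ' ∈ K θ₁ := by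
        refine sum_mem fun θ' hθ' => ?_
        have hne' := Finset.ne_of_mem_erase hθ'
        by_cases had' : G.Adj (Sum.inl θ') (Sum.inr π)
        · have h3 := hfar hreachπ hadj hlt had' (by simpa using hne')
          have hNθ' := hN (Sum.inl θ')
          have hne1 : θ' ≠ θ₁ := by
            rintro rfl
            simp [hh] at h3
          refine mul_mem (ih (N - h (Sum.inl θ')) ?_ θ' π hne1 had'
            (hreachπ.trans had'.symm.reachable) ?_) (hdK π (hS π hreachπ) _ _ hne1)
          · change h _ < h _ at hlt
            rw [max_eq_right hlt.le] at hk
            omega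
          · have := le_max_left (h (Sum.inl θ')) (h (Sum.inr π))
            omega
        · rw [hx0 _ _ had', zero_mul]; exact zero_mem _
      have h3 : x θ π = -(∑ θ' ∈ Finset.univ.erase θ, x θ' π * d π θ') / d π θ := by
        rw [eq_div_iff (hd0 π (hS π hreachπ) θ)]; linarith
      rw [h3]
      exact div_mem (neg_mem h2) (hdK π (hS π hreachπ) _ _ hθ)
    · have h1 := hsum θ
      rw [← Finset.add_sum_erase _ _ (Finset.mem_univ π)] at h1
      have h2 : ∑ π' ∈ Finset.univ.erase π, x θ π' ∈ K θ₁ := by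
        refine sum_mem fun π' hπ' => ?_
        have hne' := Finset.ne_of_mem_erase hπ'
        by_cases had' : G.Adj (Sum.inl θ) (Sum.inr π')
        · have h3 := hfar hreach hadj.symm hlt had'.symm (by simpa using hne')
          have hNπ' := hN (Sum.inr π')
          refine ih (N - h (Sum.inr π')) ?_ θ π' hθ had' hreach ?_
          · change h _ < h _ at hlt
            rw [max_eq_left hlt.le] at hk
            omega
          · have := le_max_right (h (Sum.inl θ)) (h (Sum.inr π'))
            omega
        · rw [hx0 _ _ had']; exact zero_mem _
      have h3 : x θ π = μ θ - ∑ π' ∈ Finset.univ.erase π, x θ π' := by linarith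
      rw [h3]
      exact sub_mem (hμK _ _) h2
  have hSπ := hS π₁ hπ₁.reachable
  have h1 := hd π₁ hSπ
  rw [← Finset.add_sum_erase _ _ (Finset.mem_univ θ₁), hxμ] at h1
  have h2 : ∑ θ ∈ Finset.univ.erase θ₁, x θ π₁ * d π₁ θ ∈ K θ₁ := by
    refine sum_mem fun θ hθ => ?_
    have hne' := Finset.ne_of_mem_erase hθ
    by_cases had' : G.Adj (Sum.inl θ) (Sum.inr π₁)
    · exact mul_mem (key N θ π₁ hne' had' (hπ₁.reachable.trans had'.symm.reachable) (by omega))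
        (hdK π₁ hSπ _ _ hne')
    · rw [hx0 _ _ had', zero_mul]; exact zero_mem _
  have h3 : d π₁ θ₁ = -(∑ θ ∈ Finset.univ.erase θ₁, x θ π₁ * d π₁ θ) / μ θ₁ := by
    rw [eq_div_iff (hμ θ₁)]; linarith
  exact hgen π₁ hSπ θ₁ (h3 ▸ div_mem (neg_mem h2) (hμK _ _))

end Flow

/-! ### Lotteries -/

section Lotteries

variable {X : Type*} [Fintype X]

theorem Lottery.nonneg (p : Lottery X) (x : X) : 0 ≤ (p : X → ℝ) x := p.2.1 x

theorem Lottery.sum_eq_one (p : Lottery X) : ∑ x, (p : X → ℝ) x = 1 := p.2.2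

theorem Lottery.exists_pos (p : Lottery X) : ∃ x, 0 < (p : X → ℝ) x := by
  by_contra! h
  have := p.sum_eq_one
  rw [Finset.sum_eq_zero fun x _ => le_antisymm (h x) (p.nonneg x)] at this
  exact zero_ne_one this

theorem Lottery.eq_zero_of_eq_one {p : Lottery X} {x y : X} (hx : (p : X → ℝ) x = 1) (h : y ≠ x) :
    (p : X → ℝ) y = 0 := by
  classical
  have h1 := p.sum_eq_one
  rw [← Finset.add_sum_erase _ _ (Finset.mem_univ x), hx] at h1
  exact (Finset.sum_eq_zero_iff_of_nonneg fun x _ => p.nonneg x).1 (by linarith) y (by simp [h])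

theorem Lottery.expect_eq_of_eq_one {p : Lottery X} {x : X} (hx : (p : X → ℝ) x = 1) (f : X → ℝ) :
    expect p f = f x := by
  unfold expect
  rw [Finset.sum_eq_single x (fun y _ h => by rw [eq_zero_of_eq_one hx h, zero_mul]) (by simp), hx,
    one_mul]

theorem Lottery.ext_of_eq_one {p q : Lottery X} {x : X} (hp : (p : X → ℝ) x = 1)
    (hq : (q : X → ℝ) x = 1) : p = q := by
  ext y
  by_cases h : y = x
  · rw [h, hp, hq]
  · rw [eq_zero_of_eq_one hp h, eq_zero_of_eq_one hq h]

/-- A lottery that is not degenerate has two distinct outcomes in its support. -/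
theorem Lottery.exists_ne_pos {p : Lottery X} (hp : ∀ x, (p : X → ℝ) x ≠ 1) :
    ∃ x y, x ≠ y ∧ 0 < (p : X → ℝ) x ∧ 0 < (p : X → ℝ) y := by
  obtain ⟨x, hx⟩ := p.exists_pos
  by_contra! h
  refine hp x ?_
  rw [← p.sum_eq_one]
  exact (Finset.sum_eq_single x (fun y _ hy => le_antisymm (h x y hy.symm hx) (p.nonneg y))
    (by simp)).symm

theorem expect_add (p : Lottery X) (f g : X → ℝ) :
    expect p (fun x => f x + g x) = expect p f + expect p g := by
  simp [expect, mul_add, Finset.sum_add_distrib]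

theorem expect_const_mul (p : Lottery X) (c : ℝ) (f : X → ℝ) :
    expect p (fun x => c * f x) = c * expect p f := by
  simp only [expect, Finset.mul_sum]
  exact Finset.sum_congr rfl fun x _ => by ring

theorem expect_comm {Y : Type*} [Fintype Y] (p : Lottery X) (q : Lottery Y) (f : X → Y → ℝ) :
    expect p (fun x => expect q (f x)) = expect q (fun y => expect p (fun x => f x y)) := by
  simp only [expect, Finset.mul_sum]
  rw [Finset.sum_comm]
  exact Finset.sum_congr rfl fun x _ => Finset.sum_congr rfl fun y _ => by ring

theorem expect_le (p : Lottery X) {f : X → ℝ} {c : ℝ} (h : ∀ x, f x ≤ c) : expect p f ≤ c := by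
  calc expect p f ≤ ∑ x, (p : X → ℝ) x * c :=
        Finset.sum_le_sum fun x _ => mul_le_mul_of_nonneg_left (h x) (p.nonneg x)
    _ = c := by rw [← Finset.sum_mul, p.sum_eq_one, one_mul]

end Lotteries

/-! ### Best responses -/

section BestResponse

variable {Θ A : Type*} [Fintype Θ] [Fintype A]

/-- A mixed action is a best response iff every action in its support is optimal. -/
theorem isBestResponse_iff {uR : A → Θ → ℝ} {ν : Lottery Θ} {p : Lottery A} :
    IsBestResponse uR ν p ↔
      ∀ a b, 0 < (p : A → ℝ) a → expect ν (uR b) ≤ expect ν (uR a) := by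
  classical
  have hswap : ∀ q : Lottery A, expect ν (fun θ => expect q (fun a => uR a θ)) =
      expect q (fun a => expect ν (uR a)) := fun q => expect_comm ν q fun θ a => uR a θ
  unfold IsBestResponse
  simp only [hswap]
  constructor
  · intro h a b ha
    obtain ⟨c, -, hc⟩ := Finset.exists_max_image Finset.univ (fun c => expect ν (uR c))
      ⟨a, Finset.mem_univ a⟩
    refine (hc b (Finset.mem_univ b)).trans ?_
    have h1 := h ⟨Pi.single c 1, single_mem_stdSimplex ℝ c⟩
    rw [Lottery.expect_eq_of_eq_one (x := c) (by simp)] at h1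
    have h2 : ∑ x, (p : A → ℝ) x * (expect ν (uR c) - expect ν (uR x)) ≤ 0 := by
      simp only [mul_sub, Finset.sum_sub_distrib, ← Finset.sum_mul, p.sum_eq_one]
      unfold expect at h1 ⊢
      linarith
    have h3 : ∀ x ∈ Finset.univ,
        0 ≤ (p : A → ℝ) x * (expect ν (uR c) - expect ν (uR x)) := fun x hx =>
      mul_nonneg (p.nonneg x) (sub_nonneg.2 (hc x hx))
    have h4 := (Finset.sum_eq_zero_iff_of_nonneg h3).1 (le_antisymm h2 (Finset.sum_nonneg h3)) a
      (Finset.mem_univ a)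
    have := (mul_eq_zero.1 h4).resolve_left ha.ne'
    linarith
  · intro h q
    obtain ⟨a, ha⟩ := p.exists_pos
    refine (expect_le q fun b => h a b ha).trans ?_
    rw [← one_mul (expect ν (uR a)), ← p.sum_eq_one, Finset.sum_mul]
    refine Finset.sum_le_sum fun b _ => ?_
    rcases (p.nonneg b).eq_or_lt with hb | hb
    · rw [← hb, zero_mul, zero_mul]
    · exact mul_le_mul_of_nonneg_left (h b a hb) hb.le

/-- Shifting mass within its support keeps a mixed action optimal. -/
theorem IsBestResponse.of_support {uR : A → Θ → ℝ} {ν : Lottery Θ} {p q : Lottery A}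
    (h : IsBestResponse uR ν p) (hq : ∀ a, 0 < (q : A → ℝ) a → 0 < (p : A → ℝ) a) :
    IsBestResponse uR ν q :=
  isBestResponse_iff.2 fun a b ha => isBestResponse_iff.1 h a b (hq a ha)

theorem IsBestResponse.expect_eq {uR : A → Θ → ℝ} {ν : Lottery Θ} {p : Lottery A}
    (h : IsBestResponse uR ν p) {a b : A} (ha : 0 < (p : A → ℝ) a) (hb : 0 < (p : A → ℝ) b) :
    expect ν (uR a) = expect ν (uR b) :=
  le_antisymm (isBestResponse_iff.1 h b a hb) (isBestResponse_iff.1 h a b ha)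

end BestResponse

/-! ### The communication graph -/

section CommGraph

variable {Θ A M T : Type*} [Fintype Θ] [Fintype A] (σ : Profile Θ A M) (τ : M → T)

theorem Profile.commGraph_adj {θ : Θ} {π : σ.Node τ} :
    (σ.commGraph τ).Adj (Sum.inl θ) (Sum.inr π) ↔ π.1 ∈ σ.paths τ θ := by
  simp only [Profile.commGraph, SimpleGraph.fromRel_adj]
  constructor
  · rintro ⟨-, ⟨θ', π', h1, h2, h⟩ | ⟨θ', π', h1, h2, h⟩⟩
    · cases h1; cases h2; exact h
    · cases h1
  · exact fun h => ⟨by simp, Or.inl ⟨θ, π, rfl, rfl, h⟩⟩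

theorem Profile.not_commGraph_adj_inl (θ θ' : Θ) :
    ¬ (σ.commGraph τ).Adj (Sum.inl θ) (Sum.inl θ') := by
  simp [Profile.commGraph, SimpleGraph.fromRel_adj]

theorem Profile.not_commGraph_adj_inr (π π' : σ.Node τ) :
    ¬ (σ.commGraph τ).Adj (Sum.inr π) (Sum.inr π') := by
  simp [Profile.commGraph, SimpleGraph.fromRel_adj]

theorem Profile.mem_GM_iff {v : Modification A T Θ} :
    v ∈ σ.GM τ ↔ ∀ (n : ℕ) (θ : Fin (n + 2) → Θ) (π : Fin (n + 2) → σ.Node τ),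
      IsAltPath (σ.commGraph τ) θ π →
        0 < ∑ i, (v.val (π i).1 (θ i) - v.val (π (i - 1)).1 (θ i)) :=
  ⟨fun h n θ π hA => h n θ π hA.1 hA.2 hA.3 hA.4, fun h n θ π h1 h2 h3 h4 =>
    h n θ π ⟨h1, h2, h3, h4⟩⟩

/-- A cycle, traversed in one direction and in the other, gives two opposite sums, which cannot
both be positive. -/
theorem Profile.isAcyclic_of_mem_GM {v : Modification A T Θ} (hv : v ∈ σ.GM τ) :
    (σ.commGraph τ).IsAcyclic := by
  rw [Profile.mem_GM_iff] at hv
  refine isAcyclic_of_isAltPath (σ.not_commGraph_adj_inl τ) (σ.not_commGraph_adj_inr τ)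
    fun n θ π hA hlast => ?_
  -- Arithmetic in `Fin (n + 2)` is cyclic; the closing edge is the case `j = 0`.
  have hcyc : ∀ j : Fin (n + 2),
      (σ.commGraph τ).Adj (Sum.inr (π (j - 1))) (Sum.inl (θ j)) := by
    intro j
    by_cases hj : j = 0
    · subst hj
      have : (0 - 1 : Fin (n + 2)) = Fin.last (n + 1) := by
        ext; simp
      rw [this]
      exact hlast.symm
    · refine hA.adj_succ _ _ ?_
      have : (j : ℕ) ≠ 0 := fun h => hj (Fin.ext h)
      rw [Fin.coe_sub_one, if_neg hj]
      omega
  have h1 := hv n θ π hA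
  have h2 := hv n (fun i => θ (-i)) (fun i => π (-i - 1))
    ⟨hA.inj_left.comp neg_injective,
      hA.inj_right.comp ((sub_left_injective (b := 1)).comp neg_injective),
      fun i => (hcyc (-i)).symm, fun i j hij => by
        have hj : j = i + 1 := by
          ext
          have := j.2
          rw [Fin.val_add_one_of_lt (by rw [Fin.lt_def]; simp; omega)]
          exact hij
        have : -j = -i - 1 := by rw [hj, neg_add']
        rw [this]
        exact (hA.adj _).symm⟩
  have h3 : ∑ i : Fin (n + 2), (v.val (π (-i - 1)).1 (θ (-i)) - v.val (π (-(i - 1) - 1)).1 (θ (-i)))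
      = ∑ i : Fin (n + 2), (v.val (π (i - 1)).1 (θ i) - v.val (π i).1 (θ i)) := by
    rw [← Equiv.sum_comp (Equiv.neg (Fin (n + 2)))]
    refine Finset.sum_congr rfl fun i _ => ?_
    simp
  rw [h3] at h2
  have h4 := add_pos h1 h2
  rw [← Finset.sum_add_distrib] at h4
  simp at h4

end CommGraph

/-! ### Equilibria of the transparent game -/

section Equilibrium

variable {Θ A M T : Type*} [Fintype Θ] [Fintype A] {μ : Θ → ℝ} {τ : M → T} {u0 : A → T → ℝ}
  {uR : A → Θ → ℝ} {σ : Profile Θ A M}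

theorem Profile.send_eq_zero {m : M} (h : ¬ σ.Sent m) (θ : Θ) : σ.send θ m = 0 := by
  by_contra h'
  exact h ⟨θ, (PMF.mem_support_iff _ _).2 h'⟩

/-- The ex ante probability that the state is `θ` and the play follows `π`. -/
def Profile.weight (σ : Profile Θ A M) (τ : M → T) (μ : Θ → ℝ) (θ : Θ) (π : σ.Node τ) : ℝ :=
  μ θ * ∑' m, Set.indicator {m | (σ.act m, τ m) = π.1} (fun m => (σ.send θ m).toReal) m

theorem Profile.summable_send (σ : Profile Θ A M) (θ : Θ) :
    Summable fun m => (σ.send θ m).toReal :=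
  ENNReal.summable_toReal (by rw [PMF.tsum_coe]; exact ENNReal.one_ne_top)

theorem Profile.weight_ne_zero_iff (hμ : ∀ θ, 0 < μ θ) {θ : Θ} {π : σ.Node τ} :
    σ.weight τ μ θ π ≠ 0 ↔ π.1 ∈ σ.paths τ θ := by
  have hnn : ∀ m, 0 ≤ Set.indicator {m | (σ.act m, τ m) = π.1}
      (fun m => (σ.send θ m).toReal) m :=
    fun m => Set.indicator_nonneg (fun _ _ => ENNReal.toReal_nonneg) m
  have hs : Summable (Set.indicator {m | (σ.act m, τ m) = π.1}
      (fun m => (σ.send θ m).toReal)) := (σ.summable_send θ).indicator _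
  unfold Profile.weight
  rw [mul_ne_zero_iff_left (hμ θ).ne']
  constructor
  · intro h
    obtain ⟨m, hm⟩ : ∃ m, Set.indicator {m | (σ.act m, τ m) = π.1}
        (fun m => (σ.send θ m).toReal) m ≠ 0 := by
      by_contra! h'
      exact h (by simp [h'])
    have hmem := Set.mem_of_indicator_ne_zero hm
    refine ⟨m, ?_, hmem.symm⟩
    rw [Set.indicator_of_mem hmem] at hm
    rw [PMF.mem_support_iff]
    intro h0
    simp [h0] at hm
  · rintro ⟨m, hm, hπ⟩
    refine (hs.tsum_pos hnn m ?_).ne'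
    rw [Set.indicator_of_mem (by exact hπ.symm)]
    exact ENNReal.toReal_pos ((PMF.mem_support_iff _ _).1 hm) ((σ.send θ).apply_ne_top m)

/-- In every state each message that is sent belongs to exactly one node. -/
theorem Profile.sum_weight [Fintype (σ.Node τ)] (μ : Θ → ℝ) (θ : Θ) :
    ∑ π, σ.weight τ μ θ π = μ θ := by
  unfold Profile.weight
  rw [← Finset.mul_sum, ← Summable.tsum_finsetSum fun π _ => (σ.summable_send θ).indicator _]
  have : ∀ m, ∑ π : σ.Node τ, Set.indicator {m | (σ.act m, τ m) = π.1}
      (fun m => (σ.send θ m).toReal) m = (σ.send θ m).toReal := by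
    intro m
    by_cases hm : m ∈ (σ.send θ).support
    · rw [Finset.sum_eq_single ⟨(σ.act m, τ m), θ, m, hm, rfl⟩]
      · rw [Set.indicator_of_mem (by rfl)]
      · intro π _ hπ
        refine Set.indicator_of_notMem (fun h => hπ (Subtype.ext ?_)) _
        exact Eq.symm h
      · simp
    · have h0 : σ.send θ m = 0 := by simpa [PMF.mem_support_iff] using hm
      refine (Finset.sum_eq_zero fun π _ => ?_).trans (by simp [h0])
      simp [h0]
  simp only [this]
  rw [← ENNReal.tsum_toReal_eq fun m => (σ.send θ).apply_ne_top m, PMF.tsum_coe]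
  simp

/-- The receiver is indifferent between any two actions in the support of an equilibrium action,
given the information contained in that action and the payoff-relevant content. -/
theorem IsEquilibrium.sum_weight_mul {uS : A → T → Θ → ℝ} (h : IsEquilibrium μ τ uS uR σ)
    (π : σ.Node τ) {a b : A} (ha : 0 < (π.1.1 : A → ℝ) a) (hb : 0 < (π.1.1 : A → ℝ) b) :
    ∑ θ, σ.weight τ μ θ π * (uR a θ - uR b θ) = 0 := by
  have h1 : ∀ θ, σ.weight τ μ θ π * (uR a θ - uR b θ) =
      ∑' m, Set.indicator {m | (σ.act m, τ m) = π.1}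
        (fun m => (σ.send θ m).toReal) m * (μ θ * (uR a θ - uR b θ)) := by
    intro θ
    rw [tsum_mul_right, Profile.weight]
    ring
  simp only [h1]
  rw [← Summable.tsum_finsetSum fun θ _ => ((σ.summable_send θ).indicator _).mul_right _]
  refine (tsum_congr fun m => ?_).trans tsum_zero
  by_cases hπ : (σ.act m, τ m) = π.1
  swap
  · exact Finset.sum_eq_zero fun θ _ => by
      rw [Set.indicator_of_notMem (by exact hπ), zero_mul]
  by_cases hm : σ.Sent m
  swap
  · exact Finset.sum_eq_zero fun θ _ => by
      rw [Set.indicator_of_mem (by exact hπ), Profile.send_eq_zero hm]; simp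
  have hact : σ.act m = π.1.1 := congrArg Prod.fst hπ
  have heq := (h.receiver m).expect_eq (hact ▸ ha) (hact ▸ hb)
  have hB := h.bayes m hm
  set P := ∑ θ', μ θ' * (σ.send θ' m).toReal
  calc _ = ∑ θ, P * ((σ.belief m : Θ → ℝ) θ * uR a θ - (σ.belief m : Θ → ℝ) θ * uR b θ) := by
        refine Finset.sum_congr rfl fun θ _ => ?_
        rw [Set.indicator_of_mem (by exact hπ)]
        linear_combination -(uR a θ - uR b θ) * hB θ
    _ = P * (expect (σ.belief m) (uR a) - expect (σ.belief m) (uR b)) := by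
        rw [← Finset.mul_sum, Finset.sum_sub_distrib]; rfl
    _ = 0 := by rw [heq, sub_self, mul_zero]

/-- With transparent preferences, all on-path messages give the sender the same payoff. -/
theorem IsEquilibrium.payoff_eq (h : IsEquilibrium μ τ (transparent u0) uR σ) {m m' : M}
    (hm : σ.Sent m) (hm' : σ.Sent m') :
    expect (σ.act m) (fun a => u0 a (τ m)) = expect (σ.act m') (fun a => u0 a (τ m')) := by
  obtain ⟨θ, hθ⟩ := hm
  obtain ⟨θ', hθ'⟩ := hm'
  exact le_antisymm (h.sender θ' m' hθ' m) (h.sender θ m hθ m')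

theorem Profile.Node.exists_sent (π : σ.Node τ) : ∃ m, σ.Sent m ∧ π.1 = (σ.act m, τ m) := by
  obtain ⟨θ, m, hm, h⟩ := π.2
  exact ⟨m, ⟨θ, hm⟩, h⟩

theorem IsEquilibrium.node_payoff_eq (h : IsEquilibrium μ τ (transparent u0) uR σ)
    (π π' : σ.Node τ) :
    expect π.1.1 (fun a => u0 a π.1.2) = expect π'.1.1 (fun a => u0 a π'.1.2) := by
  obtain ⟨m, hm, e⟩ := π.exists_sent
  obtain ⟨m', hm', e'⟩ := π'.exists_sent
  rw [e, e']
  exact h.payoff_eq hm hm'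

/-- The equilibrium paths along which the receiver plays a pure action. -/
def Profile.pureNodes (σ : Profile Θ A M) (τ : M → T) : Set (σ.Node τ) :=
  {π | ∃ a, (π.1.1 : A → ℝ) a = 1}

theorem Profile.exists_ne_pos_of_notMem_pureNodes {π : σ.Node τ} (h : π ∉ σ.pureNodes τ) :
    ∃ a b, a ≠ b ∧ 0 < (π.1.1 : A → ℝ) a ∧ 0 < (π.1.1 : A → ℝ) b :=
  Lottery.exists_ne_pos fun a ha => h ⟨a, ha⟩

/-- By (S) two pure nodes with the same payoff have the same action, hence the same content. -/
theorem IsEquilibrium.pureNodes_subsingleton (h : IsEquilibrium μ τ (transparent u0) uR σ)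
    (hS : AssumptionS τ u0) (hR : σ.NoRedundantPure τ) : (σ.pureNodes τ).Subsingleton := by
  rintro π ⟨a, ha⟩ π' ⟨a', ha'⟩
  obtain ⟨m, hm, e⟩ := π.exists_sent
  obtain ⟨m', hm', e'⟩ := π'.exists_sent
  rw [e] at ha
  rw [e'] at ha'
  have h1 := h.payoff_eq hm hm'
  rw [Lottery.expect_eq_of_eq_one ha, Lottery.expect_eq_of_eq_one ha'] at h1
  have h2 : a = a' := by
    by_contra hne
    exact hS a a' hne m m' h1
  subst h2
  refine Subtype.ext (e.trans (Eq.trans ?_ e'.symm))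
  exact Prod.ext (Lottery.ext_of_eq_one ha ha') (hR m m' hm hm' a ha ha')

/-- For generic receiver utilities, a mixed action is never played in a single state only. -/
theorem IsEquilibrium.exists_adj_ne_adj (h : IsEquilibrium μ τ (transparent u0) uR σ)
    (hμ : ∀ θ, 0 < μ θ) (hgen : IsGeneric μ uR) {π : σ.Node τ} (hπ : π ∉ σ.pureNodes τ) :
    ∃ θ θ', θ ≠ θ' ∧ (σ.commGraph τ).Adj (Sum.inl θ) (Sum.inr π) ∧
      (σ.commGraph τ).Adj (Sum.inl θ') (Sum.inr π) := by
  obtain ⟨a, b, hab, ha, hb⟩ := Profile.exists_ne_pos_of_notMem_pureNodes hπ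
  obtain ⟨θ, hθ⟩ := π.2
  by_contra! hcon
  have h1 := h.sum_weight_mul π ha hb
  rw [Finset.sum_eq_single θ _ (by simp)] at h1
  · refine mul_ne_zero ((Profile.weight_ne_zero_iff hμ).2 hθ) (fun h0 => ?_) h1
    exact hgen θ a b hab (h0 ▸ zero_mem _)
  · intro θ' _ hne
    have := hcon θ θ' hne.symm ((σ.commGraph_adj τ).2 hθ)
    rw [σ.commGraph_adj τ, ← Profile.weight_ne_zero_iff hμ, not_not] at this
    rw [this, zero_mul]

/-- Paths with a mixed action connect two states, and no two of them the same two states. -/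
theorem IsEquilibrium.finite_node (h : IsEquilibrium μ τ (transparent u0) uR σ)
    (hμ : ∀ θ, 0 < μ θ) (hgen : IsGeneric μ uR) (hS : AssumptionS τ u0)
    (hR : σ.NoRedundantPure τ) (hG : (σ.commGraph τ).IsAcyclic) : Finite (σ.Node τ) := by
  classical
  have hex : ∀ π : σ.Node τ, ∃ q : Option (Θ × Θ), (q = none → π ∈ σ.pureNodes τ) ∧
      ∀ r ∈ q, r.1 ≠ r.2 ∧ (σ.commGraph τ).Adj (Sum.inl r.1) (Sum.inr π) ∧
        (σ.commGraph τ).Adj (Sum.inl r.2) (Sum.inr π) := by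
    intro π
    by_cases hπ : π ∈ σ.pureNodes τ
    · exact ⟨none, fun _ => hπ, by simp⟩
    · obtain ⟨θ, θ', h1, h2, h3⟩ := h.exists_adj_ne_adj hμ hgen hπ
      exact ⟨some (θ, θ'), by simp, by rintro r ⟨⟩; exact ⟨h1, h2, h3⟩⟩
  choose q hq0 hq using hex
  refine Finite.of_injective q fun π π' he => ?_
  rcases hqπ : q π with _ | r
  · exact h.pureNodes_subsingleton hS hR (hq0 π hqπ) (hq0 π' (he ▸ hqπ))
  · by_contra hne
    obtain ⟨h1, h2, h3⟩ := hq π r hqπ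
    obtain ⟨-, h5, h6⟩ := hq π' r (he ▸ hqπ)
    have hA : IsAltPath (σ.commGraph τ) (n := 1) ![r.1, r.2] ![π, π'] := by
      refine ⟨?_, ?_, ?_, ?_⟩
      · intro i j hij
        fin_cases i <;> fin_cases j <;> simp_all
      · intro i j hij
        fin_cases i <;> fin_cases j <;> simp_all
      · intro i
        fin_cases i
        · exact h2
        · exact h6
      · intro i j hij
        fin_cases i <;> fin_cases j <;> simp at hij
        exact h3.symm
    exact hA.not_adj_of_isAcyclic hG h5

/-- For generic receiver utilities, an acyclic communication graph is connected: every component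
contains the unique path with a pure action. -/
theorem IsEquilibrium.exists_reachable_pureNode (h : IsEquilibrium μ τ (transparent u0) uR σ)
    (hμ : ∀ θ, 0 < μ θ) (hgen : IsGeneric μ uR) (hS : AssumptionS τ u0)
    (hR : σ.NoRedundantPure τ) (hG : (σ.commGraph τ).IsAcyclic) (w : Θ ⊕ σ.Node τ) :
    ∃ π ∈ σ.pureNodes τ, (σ.commGraph τ).Reachable w (Sum.inr π) := by
  have := h.finite_node hμ hgen hS hR hG
  have := Fintype.ofFinite (σ.Node τ)
  have hex : ∀ π : σ.Node τ, ∃ c : A × A, π ∉ σ.pureNodes τ →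
      c.1 ≠ c.2 ∧ 0 < (π.1.1 : A → ℝ) c.1 ∧ 0 < (π.1.1 : A → ℝ) c.2 := by
    intro π
    by_cases hπ : π ∈ σ.pureNodes τ
    · obtain ⟨a, -⟩ := id hπ
      exact ⟨(a, a), fun h => absurd hπ h⟩
    · obtain ⟨a, b, hab⟩ := Profile.exists_ne_pos_of_notMem_pureNodes hπ
      exact ⟨(a, b), fun _ => hab⟩
  choose c hc using hex
  refine exists_reachable_of_generic_weights hG (σ.weight τ μ) μ
    (fun π θ => uR (c π).1 θ - uR (c π).2 θ) (σ.pureNodes τ) (otherStatesField μ uR)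
    (fun θ π => (σ.commGraph_adj τ).trans (Profile.weight_ne_zero_iff hμ).symm)
    (fun θ => (hμ θ).ne') (fun θ => Profile.sum_weight μ θ) ?_
    (prior_mem_otherStatesField μ uR) ?_ ?_ ?_ w
  · exact fun π hπ => h.sum_weight_mul π (hc π hπ).2.1 (hc π hπ).2.2
  · exact fun π _ θ₁ θ hθ => sub_mem (utility_mem_otherStatesField μ uR hθ _)
      (utility_mem_otherStatesField μ uR hθ _)
  · exact fun π hπ θ₁ => hgen θ₁ _ _ (hc π hπ).1
  · rintro ⟨π, θ, hθ⟩
    exact ⟨θ, (σ.commGraph_adj τ).2 hθ⟩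

/-- All components contain a pure node, and there is at most one pure node. -/
theorem IsEquilibrium.isTree_of_isAcyclic [Nonempty Θ]
    (h : IsEquilibrium μ τ (transparent u0) uR σ)
    (hμ : ∀ θ, 0 < μ θ) (hgen : IsGeneric μ uR) (hS : AssumptionS τ u0)
    (hR : σ.NoRedundantPure τ) (hG : (σ.commGraph τ).IsAcyclic) : (σ.commGraph τ).IsTree := by
  have hre := h.exists_reachable_pureNode hμ hgen hS hR hG
  have : Nonempty (Θ ⊕ σ.Node τ) := ⟨Sum.inl (Classical.arbitrary Θ)⟩
  refine ⟨⟨fun w w' => ?_⟩, hG⟩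
  obtain ⟨π, hπ, h1⟩ := hre w
  obtain ⟨π', hπ', h2⟩ := hre w'
  rw [h.pureNodes_subsingleton hS hR hπ' hπ] at h2
  exact h1.trans h2.symm

end Equilibrium

/-! ### Modifications -/

section Modifications

variable {Θ A T : Type*}

theorem Modification.apply_le (v : Modification A T Θ) (x : (A × T) × Θ) : v x ≤ ‖v‖ :=
  (le_abs_self _).trans (lp.norm_apply_le_norm ENNReal.top_ne_zero v x)

variable [Fintype A]

theorem continuous_expect {X : Type*} [Fintype X] (f : X → ℝ) :
    Continuous fun p : Lottery X => expect p f := by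
  unfold expect
  exact continuous_finsetSum _ fun x _ =>
    ((continuous_apply x).comp continuous_subtype_val).mul continuous_const

theorem expect_perturbed (u0 : A → T → ℝ) (v : Modification A T Θ) (ε : ℝ) (p : Lottery A)
    (t : T) (θ : Θ) :
    expect p (fun a => perturbed u0 v ε a t θ) =
      expect p (fun a => u0 a t) + ε * v.val (p, t) θ := by
  unfold perturbed Modification.val
  rw [expect_add, expect_const_mul]

theorem Modification.val_add_smul (v w : Modification A T Θ) (c : ℝ) (π : Lottery A × T) (θ : Θ) :
    (v + c • w : Modification A T Θ).val π θ = v.val π θ + c * w.val π θ := by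
  unfold Modification.val
  rw [← expect_const_mul, ← expect_add]
  rfl

theorem Modification.val_le (v : Modification A T Θ) (π : Lottery A × T) (θ : Θ) :
    v.val π θ ≤ ‖v‖ :=
  expect_le _ fun _ => v.apply_le _

theorem Modification.tendsto_val (v : Modification A T Θ) {ι : Type*} {l : Filter ι}
    {p : ι → Lottery A} {q : Lottery A} (h : Tendsto p l (𝓝 q)) (t : T) (θ : Θ) :
    Tendsto (fun i => v.val (p i, t) θ) l (𝓝 (v.val (q, t) θ)) :=
  ((continuous_expect _).tendsto q).comp h

/-- Modifications separate outcomes. -/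
theorem Modification.exists_val_ne {π π' : Lottery A × T} (h : π ≠ π') (θ : Θ) :
    ∃ w : Modification A T Θ, w.val π θ ≠ w.val π' θ ∧ ∀ θ' ≠ θ, ∀ π, w.val π θ' = 0 := by
  classical
  have hval : ∀ (a : A) (t : T) (π : Lottery A × T) (θ' : Θ),
      Modification.val (lp.single ∞ ((a, t), θ) 1 : Modification A T Θ) π θ' =
        if π.2 = t ∧ θ' = θ then (π.1 : A → ℝ) a else 0 := by
    intro a t π θ'
    unfold Modification.val expect
    rw [Finset.sum_eq_single a]
    · simp [Pi.single_apply]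
    · intro b _ hb
      simp [hb]
    · simp
  by_contra! hcon
  have key : ∀ a t, (if π.2 = t then (π.1 : A → ℝ) a else 0) =
      if π'.2 = t then (π'.1 : A → ℝ) a else 0 := by
    intro a t
    by_contra hne
    obtain ⟨θ', h1, π'', h2⟩ := hcon (lp.single ∞ ((a, t), θ) 1 : Modification A T Θ)
      (by simpa [hval] using hne)
    exact h2 (by simp [hval, h1])
  obtain ⟨a, ha⟩ := π.1.exists_pos
  have ht : π'.2 = π.2 := by
    by_contra hne
    have := key a π.2
    rw [if_pos rfl, if_neg hne] at this
    exact ha.ne' this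
  refine h (Prod.ext (DFunLike.ext _ _ fun b => ?_) ht.symm)
  simpa [ht] using key b π.2

/-- A cyclic sum of differences vanishes; `0 - 1` is the last index. -/
theorem sum_sub_sub_one_eq_zero {n : ℕ} (f : Fin (n + 2) → ℝ) : ∑ i, (f i - f (i - 1)) = 0 := by
  rw [Finset.sum_sub_distrib, sub_eq_zero]
  exact (Equiv.sum_comp (Equiv.subRight (1 : Fin (n + 2))) f).symm

end Modifications

/-! ### Stability implies graph monotonicity -/

section Necessity

variable {Θ A M T : Type*} [Fintype Θ] [Fintype A] {μ : Θ → ℝ} {τ : M → T} {u0 : A → T → ℝ}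
  {uR : A → Θ → ℝ} {σ : Profile Θ A M}

/-- Adding up the sender's incentive constraints around a closed path: the transparent utility
cancels. -/
theorem sum_val_nonneg_of_convergesTo {v : Modification A T Θ} {σ' : ℝ → Profile Θ A M}
    (heq : ∀ᶠ ε in 𝓝[>] (0 : ℝ), IsEquilibrium μ τ (perturbed u0 v ε) uR (σ' ε))
    (hconv : ConvergesTo σ' σ) {n : ℕ} {θ : Fin (n + 2) → Θ} {π : Fin (n + 2) → σ.Node τ}
    (hadj : ∀ i, (π i).1 ∈ σ.paths τ (θ i)) :
    0 ≤ ∑ i, (v.val (π i).1 (θ i) - v.val (π (i - 1)).1 (θ i)) := by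
  choose m hm hπ using hadj
  have hact : ∀ i, Tendsto (fun ε => (σ' ε).act (m i)) (𝓝[>] 0) (𝓝 (σ.act (m i))) :=
    fun i => hconv.2 _ ⟨θ i, hm i⟩
  have hlim : Tendsto (fun ε => ∑ i, (v.val ((σ' ε).act (m i), τ (m i)) (θ i) -
      v.val ((σ' ε).act (m (i - 1)), τ (m (i - 1))) (θ i))) (𝓝[>] 0)
      (𝓝 (∑ i, (v.val (π i).1 (θ i) - v.val (π (i - 1)).1 (θ i)))) := by
    simp only [hπ]
    exact tendsto_finsetSum _ fun i _ =>
      (v.tendsto_val (hact i) _ _).sub (v.tendsto_val (hact (i - 1)) _ _)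
  refine ge_of_tendsto hlim ?_
  have hsupp : ∀ᶠ ε in 𝓝[>] (0 : ℝ), ∀ i, m i ∈ ((σ' ε).send (θ i)).support := by
    rw [eventually_all]
    intro i
    exact ((hconv.1 (θ i) (m i)).eventually_ne ((PMF.mem_support_iff _ _).1 (hm i))).mono
      fun ε h => (PMF.mem_support_iff _ _).2 h
  filter_upwards [heq, hsupp, self_mem_nhdsWithin] with ε hE hs hε
  have h1 : 0 ≤ ∑ i, (expect ((σ' ε).act (m i)) (fun a => perturbed u0 v ε a (τ (m i)) (θ i)) -
      expect ((σ' ε).act (m (i - 1)))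
        (fun a => perturbed u0 v ε a (τ (m (i - 1))) (θ i))) :=
    Finset.sum_nonneg fun i _ => sub_nonneg.2 (hE.sender (θ i) (m i) (hs i) (m (i - 1)))
  simp only [expect_perturbed] at h1
  have h2 := sum_sub_sub_one_eq_zero fun i => expect ((σ' ε).act (m i)) fun a => u0 a (τ (m i))
  refine nonneg_of_mul_nonneg_right (a := ε) ?_ hε
  rw [Finset.mul_sum]
  refine h1.trans_eq ?_
  rw [← sub_zero (Finset.sum _ _), ← h2, ← Finset.sum_sub_distrib]
  exact Finset.sum_congr rfl fun i _ => by ring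

/-- On an open set, the weak inequalities of `sum_val_nonneg_of_convergesTo` are strict, since they
are given by nonzero linear functionals of the modification. -/
theorem OStable.subset_GM {O : Set (Modification A T Θ)} (hO : IsOpen O)
    (h : OStable μ τ u0 uR σ O) : O ⊆ σ.GM τ := by
  intro v hv
  rw [Profile.mem_GM_iff]
  intro n θ π hA
  -- The cyclic sum of `GM` as a functional of the modification; `w` below is a direction in which
  -- it is not constant.
  set c : Modification A T Θ → ℝ :=
    fun v => ∑ i, (v.val (π i).1 (θ i) - v.val (π (i - 1)).1 (θ i)) with hc
  have hnn : ∀ v ∈ O, 0 ≤ c v := fun v hv => by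
    obtain ⟨σ', h1, h2⟩ := h v hv
    exact sum_val_nonneg_of_convergesTo h1 h2 fun i => (σ.commGraph_adj τ).1 (hA.adj i)
  have hlin : ∀ (v w : Modification A T Θ) (s : ℝ), c (v + s • w) = c v + s * c w := by
    intro v w s
    simp only [hc, Modification.val_add_smul, Finset.mul_sum, ← Finset.sum_add_distrib]
    exact Finset.sum_congr rfl fun i _ => by ring
  have hne : (π 0).1 ≠ (π (0 - 1)).1 := by
    intro h
    have h1 := hA.inj_right (Subtype.ext h)
    have h2 := congrArg Fin.val h1
    simp at h2
  obtain ⟨w, hw, hw0⟩ := Modification.exists_val_ne hne (θ 0)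
  have hcw : c w ≠ 0 := by
    simp only [hc]
    rw [Finset.sum_eq_single 0 _ (by simp)]
    · exact sub_ne_zero.2 hw
    · intro i _ hi
      have : θ i ≠ θ 0 := fun h => hi (hA.inj_left h)
      rw [hw0 _ this, hw0 _ this, sub_zero]
  have hmem : ∀ᶠ s in 𝓝 (0 : ℝ), v + (-s * c w) • w ∈ O := by
    have hcont : Continuous fun s : ℝ => v + (-s * c w) • w := by fun_prop
    exact hcont.continuousAt.eventually_mem (by simpa using hO.mem_nhds hv)
  obtain ⟨s, hs, hs0⟩ :=
    ((hmem.filter_mono (nhdsWithin_le_nhds (s := Set.Ioi 0))).and self_mem_nhdsWithin).exists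
  have h1 := hnn _ hs
  rw [hlin] at h1
  have h2 : 0 < s * (c w * c w) := mul_pos hs0 (mul_self_pos.2 hcw)
  change 0 < c v
  linarith

end Necessity

/-! ### The interior of `GM` -/

section Interior

variable {Θ A M T : Type*} [Fintype Θ] [Fintype A] {τ : M → T} {σ : Profile Θ A M}

/-- If the content identifies the message, the modification that rewards the sender by one for
every path that occurs in the state lies in the interior of `GM`: the only nonzero term of a sum
belongs to the first state, at which the last node of the path does not occur. -/
theorem Profile.exists_isOpen_subset_GM [Nonempty Θ] (hτ : Function.Injective τ)
    (hG : (σ.commGraph τ).IsAcyclic) :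
    ∃ O : Set (Modification A T Θ), IsOpen O ∧ O.Nonempty ∧ O ⊆ σ.GM τ := by
  classical
  set f : (A × T) × Θ → ℝ := fun x => if ∃ p, (p, x.1.2) ∈ σ.paths τ x.2 then 1 else 0 with hf
  have hmem : Memℓp f ∞ := memℓp_infty ⟨1, by
    rintro _ ⟨x, rfl⟩
    simp only [hf]
    split_ifs <;> simp⟩
  set v₀ : Modification A T Θ := ⟨f, hmem⟩ with hv₀
  have hval : ∀ (π : σ.Node τ) (θ : Θ), v₀.val π.1 θ = if π.1 ∈ σ.paths τ θ then 1 else 0 := by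
    intro π θ
    have hiff : (∃ p, (p, π.1.2) ∈ σ.paths τ θ) ↔ π.1 ∈ σ.paths τ θ := by
      refine ⟨?_, fun h => ⟨π.1.1, h⟩⟩
      rintro ⟨p, m, hm, e⟩
      obtain ⟨m', -, e'⟩ := π.exists_sent
      have : m = m' := by
        refine hτ ?_
        exact (congrArg Prod.snd e).symm.trans (congrArg Prod.snd e')
      exact ⟨m, hm, this ▸ e'⟩
    have h1 : v₀.val π.1 θ = expect π.1.1 (fun _ => if π.1 ∈ σ.paths τ θ then 1 else 0) := by
      unfold Modification.val
      congr 1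
      funext a
      change f _ = _
      simp only [hf, hiff]
    rw [h1]
    simp only [expect]
    rw [← Finset.sum_mul, Lottery.sum_eq_one, one_mul]
  have hcard : 0 < (Fintype.card Θ : ℝ) := by exact_mod_cast Fintype.card_pos
  refine ⟨Metric.ball v₀ (1 / (4 * Fintype.card Θ)), Metric.isOpen_ball,
    ⟨v₀, Metric.mem_ball_self (by positivity)⟩, fun v hv => ?_⟩
  rw [Profile.mem_GM_iff]
  intro n θ π hA
  rw [mem_ball_iff_norm] at hv
  have hn : ((n + 2 : ℕ) : ℝ) ≤ Fintype.card Θ := by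
    have := Fintype.card_le_of_injective θ hA.inj_left
    rw [Fintype.card_fin] at this
    exact_mod_cast this
  have hone : ∑ i, (v₀.val (π i).1 (θ i) - v₀.val (π (i - 1)).1 (θ i)) = 1 := by
    simp only [hval]
    rw [Finset.sum_eq_single 0 _ (by simp)]
    · have hl : (0 - 1 : Fin (n + 2)) = Fin.last (n + 1) := by ext; simp
      rw [if_pos ((σ.commGraph_adj τ).1 (hA.adj 0)), hl, if_neg, sub_zero]
      exact fun h => hA.not_adj_of_isAcyclic hG ((σ.commGraph_adj τ).2 h)
    · intro i _ hi
      rw [if_pos ((σ.commGraph_adj τ).1 (hA.adj i)), if_pos, sub_self]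
      refine (σ.commGraph_adj τ).1 (hA.adj_succ _ _ ?_).symm
      have : (i : ℕ) ≠ 0 := fun h => hi (Fin.ext h)
      rw [Fin.coe_sub_one, if_neg hi]
      omega
  have hsub : ∀ (π : Lottery A × T) (θ : Θ), |v.val π θ - v₀.val π θ| ≤ ‖v - v₀‖ := by
    intro π θ
    have h1 := Modification.val_le (v - v₀) π θ
    have h2 := Modification.val_le (v₀ - v) π θ
    have h3 := Modification.val_add_smul v v₀ (-1) π θ
    have h4 := Modification.val_add_smul v₀ v (-1) π θ
    rw [neg_one_smul, ← sub_eq_add_neg] at h3 h4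
    rw [norm_sub_rev] at h2
    rw [abs_le]
    constructor <;> linarith
  have hge : ∑ i, ((v₀.val (π i).1 (θ i) - v₀.val (π (i - 1)).1 (θ i)) - 2 * ‖v - v₀‖) ≤
      ∑ i, (v.val (π i).1 (θ i) - v.val (π (i - 1)).1 (θ i)) := by
    refine Finset.sum_le_sum fun i _ => ?_
    have h1 := (abs_le.1 (hsub (π i).1 (θ i))).1
    have h2 := (abs_le.1 (hsub (π (i - 1)).1 (θ i))).2
    linarith
  refine lt_of_lt_of_le ?_ hge
  rw [Finset.sum_sub_distrib, hone, Finset.sum_const, Finset.card_univ, Fintype.card_fin,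
    nsmul_eq_mul]
  have h1 : ((n + 2 : ℕ) : ℝ) * (2 * ‖v - v₀‖) ≤ Fintype.card Θ * (2 * ‖v - v₀‖) :=
    mul_le_mul_of_nonneg_right hn (by positivity)
  rw [lt_div_iff₀ (by positivity)] at hv
  nlinarith

end Interior

/-! ### Shifting a lottery within its support -/

section Shift

variable {A : Type*} [Fintype A]

open Classical in
/-- The lottery `p + s D`, or `p` itself if this is not a lottery. -/
def Lottery.shift (p : Lottery A) (D : A → ℝ) (s : ℝ) : Lottery A :=
  if h : (p : A → ℝ) + s • D ∈ stdSimplex ℝ A then ⟨_, h⟩ else p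

theorem Lottery.shift_support {p : Lottery A} {D : A → ℝ}
    (hD : ∀ a, D a ≠ 0 → 0 < (p : A → ℝ) a) (s : ℝ) (a : A)
    (ha : 0 < (p.shift D s : A → ℝ) a) : 0 < (p : A → ℝ) a := by
  unfold Lottery.shift at ha
  split_ifs at ha with h
  · by_cases h0 : D a = 0
    · change 0 < (p : A → ℝ) a + s * D a at ha
      rwa [h0, mul_zero, add_zero] at ha
    · exact hD a h0
  · exact ha

theorem Lottery.eventually_shift {p : Lottery A} {D : A → ℝ}
    (hD : ∀ a, D a ≠ 0 → 0 < (p : A → ℝ) a) (hD0 : ∑ a, D a = 0) {ι : Type*} {l : Filter ι}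
    {s : ι → ℝ} (hs : Tendsto s l (𝓝 0)) :
    ∀ᶠ i in l, ∀ a, (p.shift D (s i) : A → ℝ) a = (p : A → ℝ) a + s i * D a := by
  have hpos : ∀ᶠ i in l, ∀ a, 0 ≤ (p : A → ℝ) a + s i * D a := by
    rw [eventually_all]
    intro a
    by_cases h0 : D a = 0
    · exact Eventually.of_forall fun i => by rw [h0, mul_zero, add_zero]; exact p.nonneg a
    · have : Tendsto (fun i => (p : A → ℝ) a + s i * D a) l (𝓝 ((p : A → ℝ) a + 0 * D a)) :=
        (hs.mul_const _).const_add _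
      rw [zero_mul, add_zero] at this
      exact (this.eventually (lt_mem_nhds (hD a h0))).mono fun _ => le_of_lt
  filter_upwards [hpos] with i hi a
  have hmem : (p : A → ℝ) + s i • D ∈ stdSimplex ℝ A := by
    refine ⟨hi, ?_⟩
    have h1 : ∑ a, ((p : A → ℝ) + s i • D) a = ∑ a, (p : A → ℝ) a + s i * ∑ a, D a := by
      simp only [Finset.mul_sum, ← Finset.sum_add_distrib]
      rfl
    rw [h1, hD0, mul_zero, add_zero]
    exact p.sum_eq_one
  unfold Lottery.shift
  rw [dif_pos hmem]
  rfl

theorem Lottery.tendsto_shift {p : Lottery A} {D : A → ℝ}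
    (hD : ∀ a, D a ≠ 0 → 0 < (p : A → ℝ) a) (hD0 : ∑ a, D a = 0) {ι : Type*} {l : Filter ι}
    {s : ι → ℝ} (hs : Tendsto s l (𝓝 0)) : Tendsto (fun i => p.shift D (s i)) l (𝓝 p) := by
  rw [tendsto_subtype_rng, tendsto_pi_nhds]
  intro a
  have h1 : Tendsto (fun i => (p : A → ℝ) a + s i * D a) l (𝓝 ((p : A → ℝ) a + 0 * D a)) :=
    (hs.mul_const _).const_add _
  rw [zero_mul, add_zero] at h1
  refine h1.congr' ?_
  filter_upwards [Lottery.eventually_shift hD hD0 hs] with i hi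
  exact (hi a).symm

theorem expect_of_eq_add {p q : Lottery A} {D : A → ℝ} {s : ℝ}
    (h : ∀ a, (q : A → ℝ) a = (p : A → ℝ) a + s * D a) (f : A → ℝ) :
    expect q f = expect p f + s * ∑ a, D a * f a := by
  unfold expect
  simp only [h, Finset.mul_sum, ← Finset.sum_add_distrib]
  exact Finset.sum_congr rfl fun a _ => by ring

end Shift

/-! ### Graph monotonicity implies stability -/

section Sufficiency

variable {Θ A M T : Type*} [Fintype Θ] [Fintype A] {μ : Θ → ℝ} {τ : M → T} {u0 : A → T → ℝ}
  {uR : A → Θ → ℝ} {σ : Profile Θ A M}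

/-- Along every path with a mixed action, mass can be shifted within the support of the action so
that the transparent payoff of the sender changes. -/
theorem exists_shift_direction (hS : AssumptionS τ u0) (π : σ.Node τ) :
    ∃ D : A → ℝ, ∑ a, D a = 0 ∧ (∀ a, D a ≠ 0 → 0 < (π.1.1 : A → ℝ) a) ∧
      (π ∉ σ.pureNodes τ → ∑ a, D a * u0 a π.1.2 ≠ 0) := by
  classical
  by_cases hπ : π ∈ σ.pureNodes τ
  · exact ⟨0, by simp, by simp, fun h => absurd hπ h⟩
  obtain ⟨a, b, hab, ha, hb⟩ := Profile.exists_ne_pos_of_notMem_pureNodes hπ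
  obtain ⟨m, -, e⟩ := π.exists_sent
  refine ⟨Pi.single a 1 - Pi.single b 1, by simp, fun c hc => ?_, fun _ => ?_⟩
  · by_cases hca : c = a
    · exact hca ▸ ha
    by_cases hcb : c = b
    · exact hcb ▸ hb
    · simp [hca, hcb] at hc
  · simp only [Pi.sub_apply, sub_mul, Finset.sum_sub_distrib, Pi.single_apply, ite_mul, one_mul,
      zero_mul, Finset.sum_ite_eq', Finset.mem_univ, if_true]
    rw [e]
    exact sub_ne_zero.2 (hS a b hab m m)

/-- The mixed actions can be shifted so that in every state the sender remains indifferent between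
all paths of that state: starting from the pure action, whose payoffs are given, the payoffs and
shifts are determined successively along the tree. Here `s π` is the size of the shift along `π` in
the direction `D π`, and `U θ` is the change of the sender's payoff in state `θ`. -/
theorem exists_indifferent_shift [Finite (σ.Node τ)] (hG : (σ.commGraph τ).IsTree)
    (hpure : (σ.pureNodes τ).Subsingleton) {π₀ : σ.Node τ} (hπ₀ : π₀ ∈ σ.pureNodes τ)
    (v : Modification A T Θ) (D : σ.Node τ → A → ℝ)
    (hD : ∀ π ∉ σ.pureNodes τ, ∑ a, D π a * u0 a π.1.2 ≠ 0) :
    ∃ (s : σ.Node τ → ℝ → ℝ) (U : Θ → ℝ → ℝ), (∀ π, Tendsto (s π) (𝓝[>] 0) (𝓝 0)) ∧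
      (∀ θ, Tendsto (U θ) (𝓝[>] 0) (𝓝 0)) ∧
      ∀ θ π, π.1 ∈ σ.paths τ θ → ∀ᶠ ε in 𝓝[>] (0 : ℝ),
        s π ε * ∑ a, D π a * u0 a π.1.2 +
          ε * (v.val π.1 θ + s π ε * ∑ a, D π a * v ((a, π.1.2), θ)) = U θ ε := by
  have hε : Tendsto (fun ε : ℝ => ε) (𝓝[>] 0) (𝓝 0) := nhdsWithin_le_nhds
  set pay : σ.Node τ → Θ → ℝ → ℝ → ℝ := fun π θ s ε => s * ∑ a, D π a * u0 a π.1.2 +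
    ε * (v.val π.1 θ + s * ∑ a, D π a * v ((a, π.1.2), θ)) with hpay
  obtain ⟨f, hf, hR⟩ := exists_forall_adj_of_isTree hG (Sum.inr π₀) (X := ℝ → ℝ)
    (fun _ g => Tendsto g (𝓝[>] 0) (𝓝 0))
    (fun u w x y => match u, w with
      | Sum.inl θ, Sum.inr π => ∀ᶠ ε in 𝓝[>] (0 : ℝ), pay π θ (y ε) ε = x ε
      | Sum.inr π, Sum.inl θ => ∀ᶠ ε in 𝓝[>] (0 : ℝ), pay π θ (x ε) ε = y ε
      | _, _ => True)
    (by rintro (θ | π) (θ' | π') x y h <;> exact h)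
    ⟨fun _ => 0, tendsto_const_nhds⟩
    (by
      rintro (θ | π) (θ' | π') x hadj hne hx
      · exact absurd hadj (σ.not_commGraph_adj_inl τ _ _)
      · have hΔ := hD π' fun h => hne (congrArg Sum.inr (hpure h hπ₀))
        have hden : Tendsto (fun ε : ℝ => ∑ a, D π' a * u0 a π'.1.2 +
            ε * ∑ a, D π' a * v ((a, π'.1.2), θ)) (𝓝[>] 0)
            (𝓝 (∑ a, D π' a * u0 a π'.1.2 + 0 * ∑ a, D π' a * v ((a, π'.1.2), θ))) :=
          (hε.mul_const _).const_add _
        rw [zero_mul, add_zero] at hden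
        refine ⟨fun ε => (x ε - ε * v.val π'.1 θ) / (∑ a, D π' a * u0 a π'.1.2 +
            ε * ∑ a, D π' a * v ((a, π'.1.2), θ)), ?_, ?_⟩
        · have := (hx.sub (hε.mul_const (v.val π'.1 θ))).div hden hΔ
          simp only [zero_mul, sub_zero, zero_div] at this
          exact this
        · filter_upwards [hden.eventually_ne hΔ] with ε h
          simp only [hpay]
          field_simp
          ring
      · refine ⟨fun ε => pay π θ' (x ε) ε, ?_, Eventually.of_forall fun _ => rfl⟩
        have := (hx.mul_const (∑ a, D π a * u0 a π.1.2)).add (hε.mul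
          ((hx.mul_const (∑ a, D π a * v ((a, π.1.2), θ'))).const_add (v.val π.1 θ')))
        simpa using this
      · exact absurd hadj (σ.not_commGraph_adj_inr τ _ _))
  exact ⟨fun π => f (Sum.inr π), fun θ => f (Sum.inl θ), fun π => hf _, fun θ => hf _,
    fun θ π h => hR (Sum.inl θ) (Sum.inr π) ((σ.commGraph_adj τ).2 h)⟩

/-- Graph monotonicity makes the indifferences along the edges of the communication graph
incentive compatible: the gain from not deviating to a distant path is, up to the factor `ε` and in
the limit, the positive sum along the graph path that leads to it. -/
theorem eventually_payoff_le [Finite (σ.Node τ)] (hG : (σ.commGraph τ).IsTree)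
    {v : Modification A T Θ} (hv : v ∈ σ.GM τ) {q : σ.Node τ → ℝ → Lottery A} {V : Θ → ℝ → ℝ}
    (hq : ∀ π, Tendsto (q π) (𝓝[>] 0) (𝓝 π.1.1))
    (heq : ∀ θ (π : σ.Node τ), π.1 ∈ σ.paths τ θ → ∀ᶠ ε in 𝓝[>] (0 : ℝ),
      expect (q π ε) (fun a => perturbed u0 v ε a π.1.2 θ) = V θ ε) :
    ∀ᶠ ε in 𝓝[>] (0 : ℝ), ∀ θ (π : σ.Node τ),
      expect (q π ε) (fun a => perturbed u0 v ε a π.1.2 θ) ≤ V θ ε := by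
  rw [eventually_all]
  intro θ
  rw [eventually_all]
  intro π
  by_cases hadj : π.1 ∈ σ.paths τ θ
  · exact (heq θ π hadj).mono fun _ => le_of_eq
  obtain ⟨n, θs, πs, hA, rfl, rfl⟩ := exists_isAltPath_of_not_adj (σ.not_commGraph_adj_inl τ)
    (σ.not_commGraph_adj_inr τ) (hG.connected.preconnected (Sum.inl θ) (Sum.inr π))
    (fun h => hadj ((σ.commGraph_adj τ).1 h))
  have hpos := (σ.mem_GM_iff τ).1 hv n θs πs hA
  have hlim : Tendsto (fun ε => ∑ i, (v.val (q (πs i) ε, (πs i).1.2) (θs i) -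
      v.val (q (πs (i - 1)) ε, (πs (i - 1)).1.2) (θs i))) (𝓝[>] 0)
      (𝓝 (∑ i, (v.val (πs i).1 (θs i) - v.val (πs (i - 1)).1 (θs i)))) :=
    tendsto_finsetSum _ fun i _ =>
      (v.tendsto_val (hq (πs i)) _ _).sub (v.tendsto_val (hq (πs (i - 1))) _ _)
  have hprev : ∀ i : Fin (n + 2), i ≠ 0 → (πs (i - 1)).1 ∈ σ.paths τ (θs i) := by
    intro i hi
    refine (σ.commGraph_adj τ).1 (hA.adj_succ _ _ ?_).symm
    have : (i : ℕ) ≠ 0 := fun h => hi (Fin.ext h)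
    rw [Fin.coe_sub_one, if_neg hi]
    omega
  have h1 := eventually_all.2 fun i => heq (θs i) (πs i) ((σ.commGraph_adj τ).1 (hA.adj i))
  have h2 : ∀ᶠ ε in 𝓝[>] (0 : ℝ), ∀ i : Fin (n + 2), i ≠ 0 →
      expect (q (πs (i - 1)) ε) (fun a => perturbed u0 v ε a (πs (i - 1)).1.2 (θs i)) =
        V (θs i) ε :=
    eventually_all.2 fun i => by
      by_cases hi : i = 0
      · exact Eventually.of_forall fun _ h => absurd hi h
      · exact (heq _ _ (hprev i hi)).mono fun _ h _ => h
  filter_upwards [h1, h2, hlim.eventually (lt_mem_nhds hpos), self_mem_nhdsWithin] with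
    ε h1 h2 h3 hε
  have h4 : ∑ i, (expect (q (πs i) ε) (fun a => perturbed u0 v ε a (πs i).1.2 (θs i)) -
      expect (q (πs (i - 1)) ε) (fun a => perturbed u0 v ε a (πs (i - 1)).1.2 (θs i))) =
      V (θs 0) ε - expect (q (πs (Fin.last _)) ε)
        (fun a => perturbed u0 v ε a (πs (Fin.last _)).1.2 (θs 0)) := by
    rw [Finset.sum_eq_single 0 _ (by simp)]
    · have hl : (0 - 1 : Fin (n + 2)) = Fin.last (n + 1) := by ext; simp
      rw [h1, hl]
    · intro i _ hi
      rw [h1, h2 i hi, sub_self]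
  have h5 : ∑ i, (expect (q (πs i) ε) (fun a => perturbed u0 v ε a (πs i).1.2 (θs i)) -
      expect (q (πs (i - 1)) ε) (fun a => perturbed u0 v ε a (πs (i - 1)).1.2 (θs i))) =
      ε * ∑ i, (v.val (q (πs i) ε, (πs i).1.2) (θs i) -
        v.val (q (πs (i - 1)) ε, (πs (i - 1)).1.2) (θs i)) := by
    simp only [expect_perturbed]
    rw [← add_zero (ε * _),
      ← sum_sub_sub_one_eq_zero fun i => expect (q (πs i) ε) fun a => u0 a (πs i).1.2,
      Finset.mul_sum, ← Finset.sum_add_distrib]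
    exact Finset.sum_congr rfl fun i _ => by ring
  have h6 : 0 < ε * ∑ i, (v.val (q (πs i) ε, (πs i).1.2) (θs i) -
        v.val (q (πs (i - 1)) ε, (πs (i - 1)).1.2) (θs i)) := mul_pos hε h3
  linarith

/-- For a modification in `GM`, nearby equilibria of the perturbed games use the same sender
strategy, and receiver actions shifted within their supports. -/
theorem IsEquilibrium.exists_perturbed_of_mem_GM [Nonempty Θ]
    (h : IsEquilibrium μ τ (transparent u0) uR σ)
    (hμ : ∀ θ, 0 < μ θ) (hgen : IsGeneric μ uR) (hS : AssumptionS τ u0)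
    (hR : σ.NoRedundantPure τ) (hOff : σ.OffPathDeterred τ u0 uR)
    {v : Modification A T Θ} (hv : v ∈ σ.GM τ) :
    ∃ σ' : ℝ → Profile Θ A M,
      (∀ᶠ ε in 𝓝[>] (0 : ℝ), IsEquilibrium μ τ (perturbed u0 v ε) uR (σ' ε)) ∧
        ConvergesTo σ' σ := by
  have hac := σ.isAcyclic_of_mem_GM τ hv
  have hG := h.isTree_of_isAcyclic hμ hgen hS hR hac
  have := h.finite_node hμ hgen hS hR hac
  obtain ⟨π₀, hπ₀, -⟩ := h.exists_reachable_pureNode hμ hgen hS hR hac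
    (Sum.inl (Classical.arbitrary Θ))
  choose D hD0 hDsupp hDne using exists_shift_direction (σ := σ) hS
  obtain ⟨s, U, hs, hU, hind⟩ := exists_indifferent_shift (u0 := u0) hG
    (h.pureNodes_subsingleton hS hR) hπ₀ v D hDne
  set q : σ.Node τ → ℝ → Lottery A := fun π ε => π.1.1.shift (D π) (s π ε) with hq
  set ubar : ℝ := expect π₀.1.1 (fun a => u0 a π₀.1.2) with hubar
  have hqlim : ∀ π, Tendsto (q π) (𝓝[>] 0) (𝓝 π.1.1) := fun π =>
    Lottery.tendsto_shift (hDsupp π) (hD0 π) (hs π)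
  have heq : ∀ θ (π : σ.Node τ), π.1 ∈ σ.paths τ θ → ∀ᶠ ε in 𝓝[>] (0 : ℝ),
      expect (q π ε) (fun a => perturbed u0 v ε a π.1.2 θ) = ubar + U θ ε := by
    intro θ π hπ
    filter_upwards [hind θ π hπ, Lottery.eventually_shift (hDsupp π) (hD0 π) (hs π)] with ε h1 h2
    have h3 : expect (q π ε) (fun a => u0 a π.1.2) = _ := expect_of_eq_add h2 _
    have h4 : expect (q π ε) (fun a => v ((a, π.1.2), θ)) = _ := expect_of_eq_add h2 _
    rw [expect_perturbed, h3, h.node_payoff_eq π π₀, ← h1]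
    unfold Modification.val
    rw [h4]
    ring
  have hle := eventually_payoff_le hG hv hqlim heq
  have heq' : ∀ᶠ ε in 𝓝[>] (0 : ℝ), ∀ θ (π : σ.Node τ), π.1 ∈ σ.paths τ θ →
      expect (q π ε) (fun a => perturbed u0 v ε a π.1.2 θ) = ubar + U θ ε := by
    refine eventually_all.2 fun θ => eventually_all.2 fun π => ?_
    by_cases hπ : π.1 ∈ σ.paths τ θ
    · exact (heq θ π hπ).mono fun _ h _ => h
    · exact Eventually.of_forall fun _ h => absurd h hπ
  obtain ⟨δ, hδ, hdet⟩ := hOff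
  -- Beliefs `b` and actions `r` after all messages: a message off path copies an on-path message of
  -- the same content if there is one.
  have hex : ∀ m, ∃ (b : Lottery Θ) (r : ℝ → Lottery A), (∀ ε, IsBestResponse uR b (r ε)) ∧
      (σ.Sent m → b = σ.belief m ∧ ∃ π : σ.Node τ, π.1 = (σ.act m, τ m) ∧ r = q π) ∧
      ((∃ π : σ.Node τ, π.1.2 = τ m ∧ r = q π) ∨
        ∀ ε, expect (r ε) (fun a => u0 a (τ m)) + δ ≤ ubar) := by
    intro m
    by_cases hm : ∃ m₀, σ.Sent m₀ ∧ τ m₀ = τ m ∧ (σ.Sent m → m₀ = m)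
    · obtain ⟨m₀, hm₀, ht, hmm⟩ := hm
      obtain ⟨θ, hθ⟩ := id hm₀
      refine ⟨σ.belief m₀, q ⟨(σ.act m₀, τ m₀), θ, m₀, hθ, rfl⟩, fun ε => ?_, fun hsent => ?_,
        Or.inl ⟨_, ht, rfl⟩⟩
      · exact (h.receiver m₀).of_support fun a ha => Lottery.shift_support (hDsupp _) _ a ha
      · exact ⟨by rw [hmm hsent], _, congrArg (fun m => (σ.act m, τ m)) (hmm hsent), rfl⟩
    · have hns : ¬ σ.Sent m := fun hs => hm ⟨m, hs, rfl, fun _ => rfl⟩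
      obtain ⟨ν, p, hBR, hp⟩ := hdet m fun m₀ hm₀ ht => hm ⟨m₀, hm₀, ht, fun h => absurd h hns⟩
      refine ⟨ν, fun _ => p, fun _ => hBR, fun h => absurd h hns, Or.inr fun _ => ?_⟩
      obtain ⟨m₁, hm₁, e⟩ := π₀.exists_sent
      rw [hubar, e]
      exact hp m₁ hm₁
  choose b r hBR hon hoff using hex
  refine ⟨fun ε => ⟨σ.send, b, fun m => r m ε⟩, ?_, fun _ _ => tendsto_const_nhds, fun m hm => ?_⟩
  · have hsmall : ∀ᶠ ε in 𝓝[>] (0 : ℝ), ∀ θ, ε * ‖v‖ - δ < U θ ε := by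
      refine eventually_all.2 fun θ => ?_
      have hε : Tendsto (fun ε : ℝ => ε) (𝓝[>] 0) (𝓝 0) := nhdsWithin_le_nhds
      have h1 : Tendsto (fun ε : ℝ => U θ ε - (ε * ‖v‖ - δ)) (𝓝[>] 0)
          (𝓝 (0 - (0 * ‖v‖ - δ))) := (hU θ).sub ((hε.mul_const _).sub_const δ)
      exact (h1.eventually (lt_mem_nhds (by simpa using hδ))).mono fun ε h => sub_pos.1 h
    filter_upwards [hle, heq', hsmall, self_mem_nhdsWithin] with ε hle heq hsmall hε
    refine ⟨fun θ m hm m' => ?_, fun m hm θ => ?_, fun m => hBR m ε⟩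
    · change expect (r m' ε) _ ≤ expect (r m ε) _
      obtain ⟨-, π, hπ, hr⟩ := hon m ⟨θ, hm⟩
      have h1 := heq θ π ⟨m, hm, hπ⟩
      rw [show π.1.2 = τ m from congrArg Prod.snd hπ, ← hr] at h1
      rw [h1]
      rcases hoff m' with ⟨π', ht, hr'⟩ | hdev
      · rw [hr', ← ht]
        exact hle θ π'
      · rw [expect_perturbed]
        have h2 := hdev ε
        have h3 := mul_le_mul_of_nonneg_left (v.val_le (r m' ε, τ m') θ) (le_of_lt hε)
        have h4 := hsmall θ
        linarith
    · change (b m : Θ → ℝ) θ * _ = _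
      rw [(hon m hm).1]
      exact h.bayes m hm θ
  · obtain ⟨-, π, hπ, hr⟩ := hon m hm
    change Tendsto (r m) _ _
    rw [hr, show σ.act m = π.1.1 from (congrArg Prod.fst hπ).symm]
    exact hqlim π

end Sufficiency

end SenderReceiver

end

theorem theorem2 {Θ A M T : Type*} [Fintype Θ] [Fintype A]
    (μ : Θ → ℝ) (hμ : μ ∈ stdSimplex ℝ Θ) (hμpos : ∀ θ, 0 < μ θ)
    (τ : M → T) (u0 : A → T → ℝ) (hS : SenderReceiver.AssumptionS τ u0) :
    ∀ᵐ uR : A → Θ → ℝ ∂volume, ∀ σ : SenderReceiver.Profile Θ A M,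
      SenderReceiver.IsEquilibrium μ τ (SenderReceiver.transparent u0) uR σ →
      σ.NoRedundantPure τ → σ.OffPathDeterred τ u0 uR →
      (∀ O : Set (SenderReceiver.Modification A T Θ), IsOpen O → O.Nonempty →
        (SenderReceiver.OStable μ τ u0 uR σ O ↔ O ⊆ σ.GM τ)) ∧
      ((∃ O : Set (SenderReceiver.Modification A T Θ), IsOpen O ∧ O.Nonempty ∧
        SenderReceiver.OStable μ τ u0 uR σ O) → (σ.commGraph τ).IsTree) ∧
      (Function.Injective τ → (σ.commGraph τ).IsTree →
        ∃ O : Set (SenderReceiver.Modification A T Θ), IsOpen O ∧ O.Nonempty ∧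
          SenderReceiver.OStable μ τ u0 uR σ O) := by
  have : Nonempty Θ := by
    by_contra hempty
    rw [not_nonempty_iff] at hempty
    simpa using hμ.2
  filter_upwards [SenderReceiver.ae_isGeneric μ] with uR hgen σ h hR hOff
  have hsuff : ∀ O : Set (SenderReceiver.Modification A T Θ), O ⊆ σ.GM τ →
      SenderReceiver.OStable μ τ u0 uR σ O := fun O hO v hv =>
    h.exists_perturbed_of_mem_GM hμpos hgen hS hR hOff (hO hv)
  refine ⟨fun O hO _ => ⟨fun hst => hst.subset_GM hO, hsuff O⟩, ?_, fun hτ hG => ?_⟩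
  · rintro ⟨O, hO, ⟨v, hv⟩, hst⟩
    exact h.isTree_of_isAcyclic hμpos hgen hS hR (σ.isAcyclic_of_mem_GM τ (hst.subset_GM hO hv))
  · obtain ⟨O, hO, hne, hsub⟩ := σ.exists_isOpen_subset_GM hτ hG.isAcyclic
    exact ⟨O, hO, hne, hsuff O hsub⟩
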